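/- Let $dA$ be Lebesgue area measure on $\mathbb{C}$, let $1\le p<\infty$ and let $m\ge 0$ be an integer. **Spaces.** For $h:\mathbb{C}\to\mathbb{C}$ put $\|h\|_p=\big(\frac{p}{2\pi}\int_{\mathbb{C}}|h(v)|^pe^{-\frac p2|v|^2}dA(v)\big)^{1/p}$. The Fock–Sobolev space $\mathscr{F}^{p,m}$ is the space of entire functions $f$ with $\sum_{k=0}^m\|f^{(k)}\|_p<\infty$, normed by this sum. $L^{p,m}$ is the space of (classes of) measurable functions $h$ with finite norm $\big(\omega_{p,m}\int_{\mathbb{C}}|h(v)|^p|v|^{mp}e^{-\frac p2|v|^2}dA(v)\big)^{1/p}$, where $\omega_{p,m}=(\frac p2)^{\frac{mp}2+1}\frac1{\pi\Gamma(\frac{mp}2+1)}$. **Hankel operators.** Let $K^m(v,z)=\sum_{k=0}^\infty\frac{m!}{(k+m)!}(\bar z v)^k$ and $$P^mh(z)=\frac1{\pi\, m!}\int_{\mathbb{C}}h(v)\overline{K^m(v,z)}\,|v|^{2m}e^{-|v|^2}dA(v),$$ the (reproducing) integral projection onto entire functions. For a symbol $g$, the Hankel operator is $H_g^pf=(I-P^m)(gf)=gf-P^m(gf)$,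 $f\in\mathscr{F}^{p,m}$. **Vanishing mean oscillation.** For $r>0$ let $\mathscr{B}(z;r)$ be the closed disk and $\tilde g_r(z)=\frac1{\pi r^2}\int_{\mathscr{B}(z;r)}g\,dA$. $\mathcal{VMO}^p_r$ is the set of $g\in L^p_{loc}(\mathbb{C},dA)$ such that $$\lim_{|z|\to\infty}\Big\{\frac1{\pi r^2}\int_{\mathscr{B}(z;r)}|g(v)-\tilde g_r(z)|^pdA(v)\Big\}^{1/p}=0.$$ **Theorem.** Let $g\in\mathcal{VMO}^p_r$ for some $r>0$. Then $H_g^p$ and $H_{\bar g}^p$ are compact operators from $\mathscr{F}^{p,m}$ to $L^{p,m}$. That is, for $u=g$ and for $u=\bar g$: for every $f\in\mathscr{F}^{p,m}$ the integral defining $P^m(uf)(z)$ converges absolutely at every $z\in\mathbb{C}$, the function $uf-P^m(uf)$ lies in $L^{p,m}$, and $f\mapsto uf-P^m(uf)$ is a compact bounded linear operator $\mathscr{F}^{p,m}\to L^{p,m}$. -/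

import Mathlib

open MeasureTheory Filter Topology Set
open scoped NNReal ENNReal ComplexConjugate

noncomputable section

/-- The normalizing constant `ω_{p,m} = (p/2)^{mp/2+1} / (π Γ(mp/2+1))`. -/
def fockOmega (p : ℝ≥0) (m : ℕ) : ℝ :=
  ((p : ℝ) / 2) ^ ((m : ℝ) * p / 2 + 1) / (Real.pi * Real.Gamma ((m : ℝ) * p / 2 + 1))

/-- The measure `ω_{p,m} |v|^{mp} e^{-p|v|²/2} dA(v)` on `ℂ`. -/
def fockMeasure (p : ℝ≥0) (m : ℕ) : Measure ℂ :=
  (volume : Measure ℂ).withDensity fun v =>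
    ENNReal.ofReal (fockOmega p m * ‖v‖ ^ ((m : ℝ) * p) * Real.exp (-((p : ℝ) / 2) * ‖v‖ ^ 2))

/-- The space `L^{p,m}` of (classes of) measurable functions `h` such that
`h(v) |v|^m e^{-|v|²/2}` is in `L^p(ℂ, dA)`, with the norm
`(ω_{p,m} ∫ |h(v)|^p |v|^{mp} e^{-p|v|²/2} dA(v))^{1/p}`. -/
abbrev WeightedLp (p : ℝ≥0) (m : ℕ) : Type :=
  Lp ℂ (p : ℝ≥0∞) (fockMeasure p m)

/-- The norm of the Fock space `F^p`:
`‖h‖_p = (p/(2π) ∫ |h(v)|^p e^{-p|v|²/2} dA(v))^{1/p}` (note `ω_{p,0} = p/(2π)`). -/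
def fockNorm (p : ℝ≥0) (h : ℂ → ℂ) : ℝ :=
  (eLpNorm h (p : ℝ≥0∞) (fockMeasure p 0)).toReal

/-- The entire functions all of whose derivatives of order at most `m` lie in the Fock space
`F^p`, as a linear space of functions. -/
def fockSobolevSubmodule (p : ℝ≥0) (m : ℕ) : Submodule ℂ (ℂ → ℂ) where
  carrier := {f | Differentiable ℂ f ∧
    ∀ k ≤ m, MemLp (iteratedDeriv k f) (p : ℝ≥0∞) (fockMeasure p 0)}
  zero_mem' := by
    refine ⟨differentiable_const 0, fun k _ => ?_⟩
    have h : iteratedDeriv k (0 : ℂ → ℂ) = 0 := by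
      ext x
      change iteratedDeriv k (fun _ : ℂ => (0 : ℂ)) x = 0
      simp
    rw [h]
    exact MemLp.zero
  add_mem' := by
    rintro f g ⟨hf, hf'⟩ ⟨hg, hg'⟩
    refine ⟨hf.add hg, fun k hk => ?_⟩
    have h : iteratedDeriv k (f + g) = iteratedDeriv k f + iteratedDeriv k g := by
      ext x
      exact iteratedDeriv_add hf.contDiff.contDiffAt hg.contDiff.contDiffAt
    rw [h]
    exact (hf' k hk).add (hg' k hk)
  smul_mem' := by
    rintro c f ⟨hf, hf'⟩
    refine ⟨hf.const_smul c, fun k hk => ?_⟩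
    have h : iteratedDeriv k (c • f) = c • iteratedDeriv k f := by
      ext x
      exact iteratedDeriv_const_smul hf.contDiff.contDiffAt c
    rw [h]
    exact (hf' k hk).const_smul c

/-- The Fock-Sobolev space `F^{p,m}`; it carries the norm `∑_{k ≤ m} ‖f^{(k)}‖_p`. -/
def FockSobolev (p : ℝ≥0) (m : ℕ) : Type := fockSobolevSubmodule p m

namespace FockSobolev

variable {p : ℝ≥0} {m : ℕ}

instance : AddCommGroup (FockSobolev p m) :=
  inferInstanceAs (AddCommGroup (fockSobolevSubmodule p m))

instance : Module ℂ (FockSobolev p m) :=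
  inferInstanceAs (Module ℂ (fockSobolevSubmodule p m))

/-- The underlying entire function. -/
def toFun (f : FockSobolev p m) : ℂ → ℂ := Subtype.val (p := (· ∈ fockSobolevSubmodule p m)) f

instance : CoeFun (FockSobolev p m) fun _ => ℂ → ℂ := ⟨toFun⟩

instance : Norm (FockSobolev p m) :=
  ⟨fun f => ∑ k ∈ Finset.range (m + 1), fockNorm p (iteratedDeriv k f)⟩

theorem norm_def (f : FockSobolev p m) :
    ‖f‖ = ∑ k ∈ Finset.range (m + 1), fockNorm p (iteratedDeriv k f) := rfl

theorem differentiable (f : FockSobolev p m) : Differentiable ℂ f := f.2.1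

theorem memLp (f : FockSobolev p m) {k : ℕ} (hk : k ≤ m) :
    MemLp (iteratedDeriv k f) (p : ℝ≥0∞) (fockMeasure p 0) := f.2.2 k hk

theorem volume_absolutelyContinuous (hp : 0 < p) :
    (volume : Measure ℂ) ≪ fockMeasure p 0 := by
  have hω : 0 < fockOmega p 0 := by
    have : (0 : ℝ) < p := hp
    unfold fockOmega
    simp only [CharP.cast_eq_zero, zero_mul, zero_div, zero_add, Real.Gamma_one]
    positivity
  refine withDensity_absolutelyContinuous' ?_ ?_
  · exact Measurable.aemeasurable (by fun_prop)
  · refine Eventually.of_forall fun v => ?_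
    simp only [ne_eq, ENNReal.ofReal_eq_zero, not_le, CharP.cast_eq_zero, zero_mul,
      Real.rpow_zero]
    positivity

theorem normCore [hp : Fact (1 ≤ (p : ℝ≥0∞))] : NormedSpace.Core ℂ (FockSobolev p m) where
  norm_nonneg f := Finset.sum_nonneg fun k _ => ENNReal.toReal_nonneg
  norm_smul c f := by
    rw [norm_def, norm_def, Finset.mul_sum]
    refine Finset.sum_congr rfl fun k _ => ?_
    have h : iteratedDeriv k (c • f : FockSobolev p m) = c • iteratedDeriv k f := by
      ext x
      exact iteratedDeriv_const_smul f.differentiable.contDiff.contDiffAt c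
    rw [h, fockNorm, eLpNorm_const_smul, ENNReal.toReal_mul]
    simp [fockNorm]
  norm_triangle f g := by
    rw [norm_def, norm_def, norm_def, ← Finset.sum_add_distrib]
    refine Finset.sum_le_sum fun k hk => ?_
    have hk : k ≤ m := Nat.lt_succ_iff.1 (Finset.mem_range.1 hk)
    have h : iteratedDeriv k (f + g : FockSobolev p m)
        = iteratedDeriv k f + iteratedDeriv k g := by
      ext x
      exact iteratedDeriv_add f.differentiable.contDiff.contDiffAt
        g.differentiable.contDiff.contDiffAt
    have hf := f.memLp hk
    have hg := g.memLp hk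
    rw [h, fockNorm, fockNorm, fockNorm, ← ENNReal.toReal_add hf.2.ne hg.2.ne]
    exact ENNReal.toReal_mono (ENNReal.add_lt_top.2 ⟨hf.2, hg.2⟩).ne
      (eLpNorm_add_le hf.1 hg.1 hp.out)
  norm_eq_zero_iff f := by
    constructor
    · intro h
      have h0 : fockNorm p (iteratedDeriv 0 f) = 0 :=
        (Finset.sum_eq_zero_iff_of_nonneg (fun k _ => ENNReal.toReal_nonneg)).1 h 0 (by simp)
      have hf := f.memLp (Nat.zero_le m)
      have hp0 : 0 < p := lt_of_lt_of_le one_pos (by exact_mod_cast hp.out)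
      rw [fockNorm, ENNReal.toReal_eq_zero_iff, or_iff_left hf.2.ne,
        eLpNorm_eq_zero_iff hf.1 (by exact_mod_cast hp0.ne'), iteratedDeriv_zero] at h0
      have h1 := (volume_absolutelyContinuous hp0).ae_le h0
      have h2 : f.toFun = 0 :=
        (Continuous.ae_eq_iff_eq volume f.differentiable.continuous continuous_const).1 h1
      exact Subtype.ext h2
    · rintro rfl
      rw [norm_def]
      refine Finset.sum_eq_zero fun k _ => ?_
      have h : iteratedDeriv k (0 : FockSobolev p m) = 0 := by
        ext x
        change iteratedDeriv k (fun _ : ℂ => (0 : ℂ)) x = 0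
        simp
      simp [h, fockNorm]

instance [Fact (1 ≤ (p : ℝ≥0∞))] : NormedAddCommGroup (FockSobolev p m) :=
  NormedAddCommGroup.ofCore normCore

instance [Fact (1 ≤ (p : ℝ≥0∞))] : NormedSpace ℂ (FockSobolev p m) :=
  NormedSpace.ofCore normCore

end FockSobolev

/-- The reproducing kernel `K^m(v, z) = ∑_k m!/(k+m)! (z̄ v)^k` of `F^{2,m}`. -/
def fockKernel (m : ℕ) (v z : ℂ) : ℂ :=
  ∑' k : ℕ, ((m.factorial : ℂ) / ((k + m).factorial : ℂ)) * (conj z * v) ^ k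

/-- The integrand `h(v) conj(K^m(v,z)) |v|^{2m} e^{-|v|²}` of the projection at the point `z`. -/
def projIntegrand (m : ℕ) (h : ℂ → ℂ) (z v : ℂ) : ℂ :=
  h v * conj (fockKernel m v z) * ((‖v‖ ^ (2 * m) * Real.exp (-‖v‖ ^ 2) : ℝ) : ℂ)

/-- The projection `P^m`, written with its integral kernel:
`P^m h(z) = 1/(π m!) ∫ h(v) conj(K^m(v,z)) |v|^{2m} e^{-|v|²} dA(v)`. -/
def fockProj (m : ℕ) (h : ℂ → ℂ) (z : ℂ) : ℂ :=
  ((1 / (Real.pi * (m.factorial : ℝ)) : ℝ) : ℂ) * ∫ v, projIntegrand m h z v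

/-- The function `H_g f = (I - P^m)(g f)`. -/
def hankelFun (m : ℕ) (g f : ℂ → ℂ) (z : ℂ) : ℂ :=
  g z * f z - fockProj m (fun v => g v * f v) z

/-- `H_g^p` is (everywhere defined and) a compact operator from `F^{p,m}` to `L^{p,m}`: for every
`f ∈ F^{p,m}` the integral that defines `P^m(g f)(z)` converges absolutely at each `z`, and
`f ↦ (I - P^m)(g f)` is a compact bounded linear operator from `F^{p,m}` to `L^{p,m}`. -/
def IsCompactHankel (p : ℝ≥0) [Fact (1 ≤ (p : ℝ≥0∞))] (m : ℕ) (g : ℂ → ℂ) : Prop :=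
  (∀ (f : FockSobolev p m) (z : ℂ), Integrable (projIntegrand m (fun v => g v * f v) z)) ∧
  ∃ H : FockSobolev p m →L[ℂ] WeightedLp p m,
    (∀ f : FockSobolev p m, (H f : ℂ → ℂ) =ᵐ[volume] hankelFun m g f) ∧ IsCompactOperator H

/-- `g ∈ L^p_loc`: `g` is in `L^p(K, dA)` for each compact `K ⊆ ℂ`. -/
def MemLpLoc (p : ℝ≥0) (g : ℂ → ℂ) : Prop :=
  ∀ K : Set ℂ, IsCompact K → MemLp g (p : ℝ≥0∞) (volume.restrict K)

/-- The mean `1/(π r²) ∫_{B(z;r)} g dA` over the closed disk. -/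
def diskMean (r : ℝ) (g : ℂ → ℂ) (z : ℂ) : ℂ :=
  ((1 / (Real.pi * r ^ 2) : ℝ) : ℂ) * ∫ v in Metric.closedBall z r, g v

/-- The class `VMO_r^p`: `g ∈ L^p_loc` and
`(1/(π r²) ∫_{B(z;r)} |g(v) - g̃_r(z)|^p dA(v))^{1/p} → 0` as `|z| → ∞`. -/
def MemVMO (p : ℝ≥0) (r : ℝ) (g : ℂ → ℂ) : Prop :=
  MemLpLoc p g ∧
  Tendsto (fun z : ℂ => ((1 / (Real.pi * r ^ 2)) *
    ∫ v in Metric.closedBall z r, ‖g v - diskMean r g z‖ ^ (p : ℝ)) ^ (1 / (p : ℝ)))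
    (cocompact ℂ) (𝓝 0)

end

/-! Write g = b + a with b = `diskMean r g`. The mean b has vanishing oscillation at infinity, and
the local L^p mass of a = g - b vanishes there. Then H_g = H_b + H_a, and each summand is compact
for its own reason. Since compact operators are norm closed (`representsCompact_of_approx`), it
suffices to approximate each in operator norm by compact ones.

For a, already multiplication M_a is compact (`representsCompact_mul`). The function z^m f is
entire, so its weighted modulus at v obeys a sub-mean value inequality on B(v;r), and Tonelli bounds
the part of M_a outside a large disk by the local mass of a there. Inside the disk, Taylor
polynomials of f give finite rank approximants. Finally H_a = M_a - P^m M_a, and P^m is bounded on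
L^{p,m} (`weightedNorm_fockProj_le`).

For b, the identity P^m f = f (`fockProj_eq_self`) gives H_b f(z) = P^m((b(z) - b) f)(z). With the
weights attached, the kernel has Gaussian decay in |z - v|, while |b(z) - b(v)| ≤ ε(1 + |z - v|)^2
once |z| is large (`exists_radius_oscillation_le`). Young's inequality makes this outer part O(ε).
For |z| ≤ R, replacing b by its restriction to the disk of radius 2R gives a compact term, with an
error of the same kind (`representsCompact_hankelFun_of_oscillation`).

All this uses the embedding of F^{p,m} into L^{p,m} (`exists_weightedNorm_le_enorm`). It comes from
z̄f = f' - (f' - z̄f): the bracket is the first Taylor coefficient of a Weyl translate of f, hence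
bounded by circle means, and the estimate is iterated on z^n f. The symbol ḡ is covered because VMO
is closed under conjugation. -/

noncomputable section

/-! ### Circle means and rotation invariance -/

/-- The normalized Lebesgue measure on `(0, 2π]`. -/
def angleMeasure : Measure ℝ :=
  ENNReal.ofReal (2 * Real.pi)⁻¹ • (volume : Measure ℝ).restrict (Ioc 0 (2 * Real.pi))

instance : IsProbabilityMeasure angleMeasure := by
  constructor
  have : (0 : ℝ) < 2 * Real.pi := by positivity
  simp only [angleMeasure, Measure.smul_apply, MeasurableSet.univ, Measure.restrict_apply,
    univ_inter, Real.volume_Ioc, sub_zero, smul_eq_mul]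
  rw [← ENNReal.ofReal_mul (by positivity), inv_mul_cancel₀ this.ne', ENNReal.ofReal_one]

theorem integral_angleMeasure (φ : ℝ → ℂ) :
    ∫ θ, φ θ ∂angleMeasure = ((2 * Real.pi : ℝ) : ℂ)⁻¹ * ∫ θ in (0 : ℝ)..2 * Real.pi, φ θ := by
  have : (0 : ℝ) < 2 * Real.pi := by positivity
  rw [angleMeasure, integral_smul_measure, ENNReal.toReal_ofReal (by positivity),
    intervalIntegral.integral_of_le this.le, Complex.real_smul, Complex.ofReal_inv]

/-- The point `e^{iθ}` of the unit circle. -/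
def unitPt (θ : ℝ) : ℂ := circleMap 0 1 θ

@[simp] theorem norm_unitPt (θ : ℝ) : ‖unitPt θ‖ = 1 := by simp [unitPt]

theorem unitPt_ne_zero (θ : ℝ) : unitPt θ ≠ 0 := by
  rw [← norm_pos_iff, norm_unitPt]; exact one_pos

@[fun_prop] theorem continuous_unitPt : Continuous unitPt := continuous_circleMap 0 1

theorem conj_unitPt (θ : ℝ) : conj (unitPt θ) = (unitPt θ)⁻¹ := by
  rw [Complex.inv_def, Complex.normSq_eq_norm_sq, norm_unitPt]; simp

/-- Cauchy's formula for the Taylor coefficients of an entire function, on the circle of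
radius `‖v‖`. -/
theorem integral_unitPt_mul {F : ℂ → ℂ} (hF : Differentiable ℂ F) (j : ℕ) (v : ℂ) :
    ∫ θ, F (unitPt θ * v) * conj (unitPt θ) ^ j ∂angleMeasure
      = (j.factorial : ℂ)⁻¹ * iteratedDeriv j F 0 * v ^ j := by
  -- Cauchy's formula is used on the unit circle for u ↦ F(vu), so v = 0 needs no separate case.
  have hG : Differentiable ℂ (fun u => F (v * u)) := hF.comp (differentiable_id.const_mul v)
  have h := DiffContOnCl.circleIntegral_one_div_sub_center_pow_smul (c := 0) one_pos j
    hG.diffContOnCl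
  rw [iteratedDeriv_comp_const_mul hF.contDiff] at h
  have hpi : (Real.pi : ℂ) ≠ 0 := by exact_mod_cast Real.pi_ne_zero
  have hj : (j.factorial : ℂ) ≠ 0 := by exact_mod_cast j.factorial_ne_zero
  have h2 : ∮ z in C(0, 1), (1 / (z - 0) ^ (j + 1)) • F (v * z)
      = Complex.I * ∫ θ in (0 : ℝ)..2 * Real.pi, F (unitPt θ * v) * conj (unitPt θ) ^ j := by
    rw [circleIntegral, ← intervalIntegral.integral_const_mul]
    refine intervalIntegral.integral_congr fun θ _ => ?_
    have := unitPt_ne_zero θ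
    simp only [deriv_circleMap, smul_eq_mul, sub_zero]
    rw [conj_unitPt, ← unitPt, mul_comm v, inv_pow]
    field_simp
    ring
  rw [h2] at h
  rw [integral_angleMeasure]
  have h3 : ∫ θ in (0 : ℝ)..2 * Real.pi, F (unitPt θ * v) * conj (unitPt θ) ^ j
      = (-Complex.I) * ((2 * Real.pi * Complex.I / (j.factorial : ℂ)) •
        (v ^ j * iteratedDeriv j F (v * 0))) := by
    rw [← h, ← mul_assoc]; simp
  rw [h3]
  push_cast
  simp only [smul_eq_mul, mul_zero]
  field_simp
  simp [Complex.I_sq]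

theorem measurePreserving_unitPt_mul (θ : ℝ) :
    MeasurePreserving (fun v : ℂ => unitPt θ * v) := by
  let a : Circle := ⟨unitPt θ, by simp [Submonoid.unitSphere]⟩
  exact (rotation a).measurePreserving

/-- This supplies the joint integrability in (θ, v) that Fubini needs in
`integral_eq_integral_angle`. -/
theorem measurePreserving_prod_unitPt :
    MeasurePreserving (fun q : ℝ × ℂ => (q.1, unitPt q.1 * q.2))
      (angleMeasure.prod volume) (angleMeasure.prod volume) := by
  refine (MeasurePreserving.id angleMeasure).skew_product
    (g := fun θ v => unitPt θ * v) ?_ (ae_of_all _ fun θ => (measurePreserving_unitPt_mul θ).map_eq)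
  exact Continuous.measurable (by fun_prop)

theorem lintegral_eq_lintegral_angle {ψ : ℂ → ℝ≥0∞} (hψ : Measurable ψ) :
    ∫⁻ v, ψ v = ∫⁻ v, ∫⁻ θ, ψ (unitPt θ * v) ∂angleMeasure := by
  rw [lintegral_lintegral_swap]
  · simp_rw [(measurePreserving_unitPt_mul _).lintegral_comp hψ]
    simp
  · exact (hψ.comp (Continuous.measurable (by fun_prop))).aemeasurable

theorem integral_eq_integral_angle {φ : ℂ → ℂ} (hφ : Integrable φ) :
    ∫ v, φ v = ∫ v, ∫ θ, φ (unitPt θ * v) ∂angleMeasure := by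
  have hi : Integrable (fun q : ℝ × ℂ => φ (unitPt q.1 * q.2)) (angleMeasure.prod volume) :=
    measurePreserving_prod_unitPt.integrable_comp_of_integrable
      (g := fun q : ℝ × ℂ => φ q.2) (hφ.comp_snd angleMeasure)
  rw [← integral_integral_swap hi]
  have (θ : ℝ) : ∫ v, φ (unitPt θ * v) = ∫ v, φ v := by
    refine (measurePreserving_unitPt_mul θ).integral_comp ?_ φ
    exact (Homeomorph.mulLeft₀ _ (unitPt_ne_zero θ)).measurableEmbedding
  simp [this]

/-! ### Jensen and Young inequalities -/

/-- Jensen's inequality for powers. -/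
theorem lintegral_rpow_le_mul_lintegral_rpow {α : Type*} [MeasurableSpace α] (ν : Measure α)
    {q : ℝ} (hq : 1 ≤ q) {φ : α → ℝ≥0∞} (hφ : AEMeasurable φ ν) :
    (∫⁻ x, φ x ∂ν) ^ q ≤ ν univ ^ (q - 1) * ∫⁻ x, φ x ^ q ∂ν := by
  have hq0 : 0 < q := by linarith
  have h := eLpNorm'_le_eLpNorm'_mul_rpow_measure_univ one_pos hq hφ.aestronglyMeasurable
  simp only [eLpNorm', enorm_eq_self, ENNReal.rpow_one, div_one] at h
  calc (∫⁻ x, φ x ∂ν) ^ q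
      ≤ ((∫⁻ x, φ x ^ q ∂ν) ^ (1 / q) * ν univ ^ (1 - 1 / q)) ^ q := by gcongr
    _ = _ := by
      rw [ENNReal.mul_rpow_of_nonneg _ _ hq0.le, ← ENNReal.rpow_mul, ← ENNReal.rpow_mul,
        one_div_mul_cancel hq0.ne', ENNReal.rpow_one, mul_comm]
      congr 2
      field_simp

/-- Young's inequality for the convolution with a finite measure. -/
theorem lintegral_rpow_lintegral_add_le (ν : Measure ℂ) [IsFiniteMeasure ν] {q : ℝ} (hq : 1 ≤ q)
    {Φ : ℂ → ℝ≥0∞} (hΦ : Measurable Φ) :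
    ∫⁻ z, (∫⁻ u, Φ (z + u) ∂ν) ^ q ≤ ν univ ^ q * ∫⁻ z, Φ z ^ q := by
  have hm : Measurable (fun x : ℂ × ℂ => Φ (x.1 + x.2) ^ q) := by fun_prop
  calc ∫⁻ z, (∫⁻ u, Φ (z + u) ∂ν) ^ q
      ≤ ∫⁻ z, ν univ ^ (q - 1) * ∫⁻ u, Φ (z + u) ^ q ∂ν :=
        lintegral_mono fun z => lintegral_rpow_le_mul_lintegral_rpow ν hq (by fun_prop)
    _ = ν univ ^ (q - 1) * ∫⁻ u, (∫⁻ z, Φ (z + u) ^ q) ∂ν := by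
        rw [lintegral_const_mul _ (hm.lintegral_prod_right' (ν := ν)),
          lintegral_lintegral_swap hm.aemeasurable]
    _ = ν univ ^ (q - 1) * ((∫⁻ z, Φ z ^ q) * ν univ) := by
        congr 1
        rw [← lintegral_const]
        exact lintegral_congr fun u => lintegral_add_right_eq_self (fun z => Φ z ^ q) u
    _ = _ := by
        -- Adding the exponents q - 1 and 1 requires a nonzero base in `ℝ≥0∞`.
        rcases eq_or_ne (ν univ) 0 with h0 | h0
        · simp [h0, ENNReal.zero_rpow_of_pos (by linarith : 0 < q)]
        rw [mul_comm (∫⁻ z, Φ z ^ q), ← mul_assoc]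
        congr 1
        nth_rewrite 2 [← ENNReal.rpow_one (ν univ)]
        rw [← ENNReal.rpow_add _ _ h0 (measure_ne_top ν univ), sub_add_cancel]

/-! ### The weighted modulus and the weighted norm -/

theorem one_le_toReal_of_fact (p : ℝ≥0) [hp : Fact (1 ≤ (p : ℝ≥0∞))] : (1 : ℝ) ≤ p := by
  exact_mod_cast hp.out

/-- The weight `|v|^m e^{-|v|²/2}`. -/
def fockWeight (m : ℕ) (v : ℂ) : ℝ := ‖v‖ ^ m * Real.exp (-‖v‖ ^ 2 / 2)

theorem fockWeight_nonneg (m : ℕ) (v : ℂ) : 0 ≤ fockWeight m v := by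
  unfold fockWeight; positivity

@[fun_prop] theorem continuous_fockWeight (m : ℕ) : Continuous (fockWeight m) := by
  unfold fockWeight; fun_prop

/-- The size `|h(v)| |v|^m e^{-|v|²/2}` of `h` relative to the weight. -/
def weightedAbs (m : ℕ) (h : ℂ → ℂ) (v : ℂ) : ℝ≥0∞ := ‖(fockWeight m v : ℂ) * h v‖ₑ

/-- The `L^p(dA)` norm of `h(v) |v|^m e^{-|v|²/2}`. -/
def weightedNorm (p : ℝ≥0) (m : ℕ) (h : ℂ → ℂ) : ℝ≥0∞ :=
  eLpNorm (fun v => (fockWeight m v : ℂ) * h v) p volume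

theorem weightedAbs_eq (m : ℕ) (h : ℂ → ℂ) (v : ℂ) :
    weightedAbs m h v = ENNReal.ofReal (fockWeight m v) * ‖h v‖ₑ := by
  rw [weightedAbs, enorm_mul, ← ofReal_norm (fockWeight m v : ℂ), Complex.norm_real,
    Real.norm_of_nonneg (fockWeight_nonneg m v)]

/-- Trades the weight |v|^n for a holomorphic factor, so that estimates for entire functions with
weight index 0 apply to every index. -/
theorem weightedAbs_pow_mul (m n : ℕ) (h : ℂ → ℂ) (v : ℂ) :
    weightedAbs m (fun v => v ^ n * h v) v = weightedAbs (m + n) h v := by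
  rw [weightedAbs, weightedAbs, enorm_eq_iff_norm_eq]
  simp [fockWeight, pow_add]; ring

theorem measurable_weightedAbs (m : ℕ) {h : ℂ → ℂ} (hh : Measurable h) :
    Measurable (weightedAbs m h) := by
  unfold weightedAbs
  have := (continuous_fockWeight m).measurable
  fun_prop

theorem continuous_weightedAbs (m : ℕ) {h : ℂ → ℂ} (hh : Continuous h) :
    Continuous (weightedAbs m h) := by
  unfold weightedAbs; fun_prop

theorem weightedNorm_congr {p : ℝ≥0} {m : ℕ} {h k : ℂ → ℂ} (H : h =ᵐ[volume] k) :
    weightedNorm p m h = weightedNorm p m k :=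
  eLpNorm_congr_ae (H.mono fun v hv => by simp only [hv])

theorem weightedNorm_const_mul {p : ℝ≥0} {m : ℕ} (c : ℂ) (h : ℂ → ℂ) :
    weightedNorm p m (fun v => c * h v) = ‖c‖ₑ * weightedNorm p m h := by
  unfold weightedNorm
  rw [← eLpNorm_const_smul]
  congr 1; ext v; simp; ring

section norm

variable {p : ℝ≥0} [Fact (1 ≤ (p : ℝ≥0∞))] {m : ℕ}

theorem coe_ne_zero_of_fact : (p : ℝ≥0∞) ≠ 0 := by
  have := one_le_toReal_of_fact p
  intro h
  norm_cast at h
  rw [h] at this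
  norm_num at this

theorem weightedNorm_eq (h : ℂ → ℂ) :
    weightedNorm p m h = (∫⁻ v, weightedAbs m h v ^ (p : ℝ)) ^ (1 / (p : ℝ)) := by
  rw [weightedNorm, eLpNorm_eq_lintegral_rpow_enorm_toReal coe_ne_zero_of_fact ENNReal.coe_ne_top]
  rfl

theorem weightedNorm_rpow (h : ℂ → ℂ) :
    weightedNorm p m h ^ (p : ℝ) = ∫⁻ v, weightedAbs m h v ^ (p : ℝ) := by
  have := one_le_toReal_of_fact p
  rw [weightedNorm_eq, ← ENNReal.rpow_mul, one_div_mul_cancel (by linarith), ENNReal.rpow_one]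

theorem weightedNorm_le_of_lintegral_le {h k : ℂ → ℂ} {n : ℕ} {C : ℝ≥0∞}
    (H : ∫⁻ v, weightedAbs m h v ^ (p : ℝ) ≤ C ^ (p : ℝ) * ∫⁻ v, weightedAbs n k v ^ (p : ℝ)) :
    weightedNorm p m h ≤ C * weightedNorm p n k := by
  have := one_le_toReal_of_fact p
  rw [← weightedNorm_rpow, ← weightedNorm_rpow, ← ENNReal.mul_rpow_of_nonneg _ _ (by linarith)]
    at H
  exact (ENNReal.rpow_le_rpow_iff (by linarith)).1 H

theorem fockOmega_pos : 0 < fockOmega p m := by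
  have := one_le_toReal_of_fact p
  have h2 : 0 < Real.Gamma ((m : ℝ) * p / 2 + 1) := Real.Gamma_pos_of_pos (by positivity)
  unfold fockOmega
  positivity

theorem eLpNorm_fockMeasure (h : ℂ → ℂ) :
    eLpNorm h p (fockMeasure p m)
      = ENNReal.ofReal (fockOmega p m) ^ (1 / (p : ℝ)) * weightedNorm p m h := by
  have hp := one_le_toReal_of_fact p
  rw [weightedNorm_eq, ← ENNReal.mul_rpow_of_nonneg _ _ (by positivity),
    eLpNorm_eq_lintegral_rpow_enorm_toReal coe_ne_zero_of_fact ENNReal.coe_ne_top, fockMeasure,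
    lintegral_withDensity_eq_lintegral_mul_non_measurable _ (by fun_prop)
      (ae_of_all _ fun _ => ENNReal.ofReal_lt_top), ← lintegral_const_mul' _ _ ENNReal.ofReal_ne_top]
  simp only [ENNReal.coe_toReal, Pi.mul_apply]
  congr 1
  refine lintegral_congr fun v => ?_
  rw [weightedAbs_eq, ENNReal.mul_rpow_of_nonneg _ _ (by linarith), ← mul_assoc,
    ENNReal.ofReal_rpow_of_nonneg (fockWeight_nonneg _ _) (by linarith),
    ← ENNReal.ofReal_mul fockOmega_pos.le, mul_assoc (fockOmega p m)]
  congr 3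
  rw [fockWeight, Real.mul_rpow (by positivity) (by positivity), ← Real.rpow_natCast ‖v‖ m,
    ← Real.rpow_mul (by positivity), ← Real.exp_mul]
  congr 2
  ring

theorem weightedNorm_add_le {h k : ℂ → ℂ} (hh : AEStronglyMeasurable h volume)
    (hk : AEStronglyMeasurable k volume) :
    weightedNorm p m (fun v => h v + k v) ≤ weightedNorm p m h + weightedNorm p m k := by
  unfold weightedNorm
  simp only [mul_add]
  have hw : AEStronglyMeasurable (fun v => (fockWeight m v : ℂ)) volume := by
    exact (by fun_prop : Continuous fun v => (fockWeight m v : ℂ)).aestronglyMeasurable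
  exact eLpNorm_add_le (hw.mul hh) (hw.mul hk) Fact.out

theorem weightedNorm_pow_mul (n : ℕ) (h : ℂ → ℂ) :
    weightedNorm p m (fun v => v ^ n * h v) = weightedNorm p (m + n) h := by
  simp_rw [weightedNorm_eq, weightedAbs_pow_mul]

end norm

/-! ### Weyl translates and pointwise estimates -/

/-- The Weyl translate `u ↦ q(z+u) e^{-z̄u}`. -/
def weylTranslate (q : ℂ → ℂ) (z u : ℂ) : ℂ := q (z + u) * Complex.exp (-(conj z * u))

theorem differentiable_weylTranslate {q : ℂ → ℂ} (hq : Differentiable ℂ q) (z : ℂ) :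
    Differentiable ℂ (weylTranslate q z) := by
  unfold weylTranslate; fun_prop

theorem deriv_weylTranslate {q : ℂ → ℂ} (hq : Differentiable ℂ q) (z : ℂ) :
    deriv (weylTranslate q z) 0 = deriv q z - conj z * q z := by
  have h1 : HasDerivAt (fun u => q (z + u)) (deriv q z) 0 := by
    have := (hq (z + 0)).hasDerivAt
    simpa using this.comp_const_add z 0
  have h2 : HasDerivAt (fun u => Complex.exp (-(conj z * u))) (-conj z) 0 := by
    simpa using ((hasDerivAt_id (0 : ℂ)).const_mul (conj z)).neg.cexp
  have := (h1.mul h2).deriv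
  simp only [add_zero, mul_zero, neg_zero, Complex.exp_zero, mul_one] at this
  rw [show weylTranslate q z = (fun u => q (z + u)) * fun u => Complex.exp (-(conj z * u)) from rfl,
    this]
  ring

/-- This is |z + u|² = |z|² + 2 Re(z̄u) + |u|²: the exponential factor in the Weyl translate turns
the Gaussian at z into the Gaussian at z + u, up to e^{|u|²/2}. -/
theorem ofReal_mul_enorm_weylTranslate (q : ℂ → ℂ) (z u : ℂ) :
    ENNReal.ofReal (fockWeight 0 z) * ‖weylTranslate q z u‖ₑ
      = ENNReal.ofReal (Real.exp (‖u‖ ^ 2 / 2)) * weightedAbs 0 q (z + u) := by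
  rw [weightedAbs, ← ofReal_norm, ← ofReal_norm,
    ← ENNReal.ofReal_mul (fockWeight_nonneg _ _), ← ENNReal.ofReal_mul (by positivity)]
  congr 1
  rw [norm_mul, Complex.norm_real, Real.norm_of_nonneg (fockWeight_nonneg _ _), weylTranslate,
    norm_mul, Complex.norm_exp]
  simp only [fockWeight, pow_zero, one_mul]
  rw [mul_left_comm, ← Real.exp_add, ← mul_assoc, ← Real.exp_add, mul_comm]
  congr 2
  simp only [← Complex.normSq_eq_norm_sq, Complex.normSq_apply]
  simp
  ring

/-- Mean value property of the Weyl translate on the circle of radius |u|; its value at 0 is q(z).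
-/
theorem weightedAbs_le_lintegral_circle {q : ℂ → ℂ} (hq : Differentiable ℂ q) (z u : ℂ) :
    weightedAbs 0 q z ≤ ENNReal.ofReal (Real.exp (‖u‖ ^ 2 / 2)) *
      ∫⁻ θ, weightedAbs 0 q (z + unitPt θ * u) ∂angleMeasure := by
  have h := integral_unitPt_mul (differentiable_weylTranslate hq z) 0 u
  have h0 := ofReal_mul_enorm_weylTranslate q z 0
  simp only [pow_zero, mul_one, Nat.factorial_zero, Nat.cast_one, inv_one, one_mul,
    iteratedDeriv_zero] at h
  simp only [norm_zero, ne_eq, OfNat.ofNat_ne_zero, not_false_eq_true, zero_pow, zero_div,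
    Real.exp_zero, ENNReal.ofReal_one, one_mul, add_zero] at h0
  rw [← h0, ← h, ← lintegral_const_mul' _ _ ENNReal.ofReal_ne_top]
  calc _ ≤ ENNReal.ofReal (fockWeight 0 z) *
        ∫⁻ θ, ‖weylTranslate q z (unitPt θ * u)‖ₑ ∂angleMeasure := by
        gcongr; exact enorm_integral_le_lintegral_enorm _
    _ = _ := by
        rw [← lintegral_const_mul' _ _ ENNReal.ofReal_ne_top]
        refine lintegral_congr fun θ => ?_
        rw [ofReal_mul_enorm_weylTranslate]
        simp

/-- The quantity q' - z̄q is the first Taylor coefficient at 0 of the Weyl translate, so Cauchy's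
formula on the unit circle bounds it; e^{1/2} is e^{|u|²/2} at |u| = 1. -/
theorem weightedAbs_deriv_sub_le {q : ℂ → ℂ} (hq : Differentiable ℂ q) (z : ℂ) :
    weightedAbs 0 (fun z => deriv q z - conj z * q z) z ≤ ENNReal.ofReal (Real.exp (1 / 2)) *
      ∫⁻ θ, weightedAbs 0 q (z + unitPt θ) ∂angleMeasure := by
  have h := integral_unitPt_mul (differentiable_weylTranslate hq z) 1 1
  simp only [pow_one, mul_one, Nat.factorial_one, Nat.cast_one, inv_one, one_mul,
    iteratedDeriv_one, deriv_weylTranslate hq] at h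
  rw [weightedAbs_eq, ← h, ← lintegral_const_mul' _ _ ENNReal.ofReal_ne_top]
  calc _ ≤ ENNReal.ofReal (fockWeight 0 z) *
        ∫⁻ θ, ‖weylTranslate q z (unitPt θ) * conj (unitPt θ)‖ₑ ∂angleMeasure := by
        gcongr; exact enorm_integral_le_lintegral_enorm _
    _ = _ := by
        rw [← lintegral_const_mul' _ _ ENNReal.ofReal_ne_top]
        refine lintegral_congr fun θ => ?_
        have : ‖conj (unitPt θ)‖ₑ = 1 := by
          rw [← ofReal_norm]; simp
        rw [enorm_mul, this, mul_one, ofReal_mul_enorm_weylTranslate]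
        simp

/-! ### The embedding of F^{p,m} into L^{p,m} and point evaluations -/

section embedding

variable {p : ℝ≥0} [Fact (1 ≤ (p : ℝ≥0∞))]

/-- A sub-mean value property: the weighted modulus of an entire function is controlled by its
`p`-th power mean over a disk. -/
theorem exists_weightedAbs_rpow_le_setLIntegral {ρ : ℝ} (hρ : 0 < ρ) :
    ∃ C : ℝ≥0, ∀ q : ℂ → ℂ, Differentiable ℂ q → ∀ z,
      weightedAbs 0 q z ^ (p : ℝ)
        ≤ C * ∫⁻ u in Metric.closedBall z ρ, weightedAbs 0 q u ^ (p : ℝ) := by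
  have hp := one_le_toReal_of_fact p
  set K : ℝ≥0∞ := ENNReal.ofReal (Real.exp (ρ ^ 2 / 2)) ^ (p : ℝ) with hK
  have hKt : K ≠ ∞ := ENNReal.rpow_ne_top_of_nonneg (by linarith) ENNReal.ofReal_ne_top
  set V : ℝ≥0∞ := volume (Metric.closedBall (0 : ℂ) ρ) with hV
  have hV0 : V ≠ 0 := (Metric.measure_closedBall_pos _ _ hρ).ne'
  have hVt : V ≠ ∞ := measure_closedBall_lt_top.ne
  refine ⟨(K / V).toNNReal, fun q hq z => ?_⟩
  rw [ENNReal.coe_toNNReal (ENNReal.div_ne_top hKt hV0)]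
  have hm : Measurable fun u => weightedAbs 0 q (z + u) ^ (p : ℝ) :=
    ((continuous_weightedAbs 0 hq.continuous).measurable.comp (measurable_const_add z)).pow_const _
  have hms : MeasurableSet (Metric.closedBall (0 : ℂ) ρ) := Metric.isClosed_closedBall.measurableSet
  have h1 : ∀ u ∈ Metric.closedBall (0 : ℂ) ρ, weightedAbs 0 q z ^ (p : ℝ) ≤
      K * ∫⁻ θ, weightedAbs 0 q (z + unitPt θ * u) ^ (p : ℝ) ∂angleMeasure := by
    intro u hu
    have hu : ‖u‖ ≤ ρ := by simpa using hu
    calc weightedAbs 0 q z ^ (p : ℝ) ≤ (ENNReal.ofReal (Real.exp (‖u‖ ^ 2 / 2)) *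
          ∫⁻ θ, weightedAbs 0 q (z + unitPt θ * u) ∂angleMeasure) ^ (p : ℝ) := by
          gcongr; exact weightedAbs_le_lintegral_circle hq z u
      _ ≤ (ENNReal.ofReal (Real.exp (ρ ^ 2 / 2)) *
          ∫⁻ θ, weightedAbs 0 q (z + unitPt θ * u) ∂angleMeasure) ^ (p : ℝ) := by
          gcongr
      _ ≤ _ := by
          rw [ENNReal.mul_rpow_of_nonneg _ _ (by linarith)]
          gcongr
          refine (lintegral_rpow_le_mul_lintegral_rpow angleMeasure hp ?_).trans (by simp)
          exact ((continuous_weightedAbs 0 hq.continuous).comp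
            (by fun_prop : Continuous fun θ => z + unitPt θ * u)).measurable.aemeasurable
  have h2 : V * weightedAbs 0 q z ^ (p : ℝ)
      ≤ K * ∫⁻ u in Metric.closedBall z ρ, weightedAbs 0 q u ^ (p : ℝ) := by
    calc V * weightedAbs 0 q z ^ (p : ℝ)
        = ∫⁻ u in Metric.closedBall (0 : ℂ) ρ, weightedAbs 0 q z ^ (p : ℝ) := by
          rw [setLIntegral_const, mul_comm]
      _ ≤ ∫⁻ u in Metric.closedBall (0 : ℂ) ρ,
          K * ∫⁻ θ, weightedAbs 0 q (z + unitPt θ * u) ^ (p : ℝ) ∂angleMeasure :=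
          setLIntegral_mono' hms h1
      -- The disk is invariant under rotation, so its indicator can be evaluated at the rotated
      -- point; the angle mean then drops out.
      _ = K * ∫⁻ u, ∫⁻ θ, (Metric.closedBall (0 : ℂ) ρ).indicator
            (fun u => weightedAbs 0 q (z + u) ^ (p : ℝ)) (unitPt θ * u) ∂angleMeasure := by
          rw [lintegral_const_mul' _ _ hKt, ← lintegral_indicator hms]
          congr 1
          refine lintegral_congr fun u => ?_
          by_cases hu : ‖u‖ ≤ ρ
          · simp [indicator, hu]
          · simp [indicator, hu]
      _ = K * ∫⁻ u, (Metric.closedBall (0 : ℂ) ρ).indicator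
            (fun u => weightedAbs 0 q (z + u) ^ (p : ℝ)) u := by
          rw [← lintegral_eq_lintegral_angle (hm.indicator hms)]
      _ = _ := by
          congr 1
          rw [← lintegral_indicator Metric.isClosed_closedBall.measurableSet,
            ← lintegral_add_left_eq_self ((Metric.closedBall z ρ).indicator _) z]
          refine lintegral_congr fun u => ?_
          simp [indicator, dist_eq_norm]
  rw [ENNReal.mul_div_right_comm.symm, ENNReal.le_div_iff_mul_le (Or.inl hV0) (Or.inl hVt),
    mul_comm]
  exact h2

/-- The circle mean in `weightedAbs_deriv_sub_le` is a convolution with a probability measure, so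
Young's inequality costs no further constant. -/
theorem weightedNorm_deriv_sub_le {f : ℂ → ℂ} (hf : Differentiable ℂ f) :
    weightedNorm p 0 (fun z => deriv f z - conj z * f z)
      ≤ ENNReal.ofReal (Real.exp (1 / 2)) * weightedNorm p 0 f := by
  have hp := one_le_toReal_of_fact p
  refine weightedNorm_le_of_lintegral_le ?_
  let ν : Measure ℂ := angleMeasure.map unitPt
  have : IsProbabilityMeasure ν :=
    Measure.isProbabilityMeasure_map continuous_unitPt.measurable.aemeasurable
  have hc := continuous_weightedAbs 0 hf.continuous
  calc _ ≤ ∫⁻ z, (ENNReal.ofReal (Real.exp (1 / 2)) *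
        ∫⁻ u, weightedAbs 0 f (z + u) ∂ν) ^ (p : ℝ) := by
        refine lintegral_mono fun z => ?_
        dsimp only
        gcongr
        rw [lintegral_map (f := fun u => weightedAbs 0 f (z + u))
          (hc.measurable.comp (measurable_const_add z)) continuous_unitPt.measurable]
        exact weightedAbs_deriv_sub_le hf z
    _ = ENNReal.ofReal (Real.exp (1 / 2)) ^ (p : ℝ) *
        ∫⁻ z, (∫⁻ u, weightedAbs 0 f (z + u) ∂ν) ^ (p : ℝ) := by
        simp_rw [ENNReal.mul_rpow_of_nonneg _ _ (by linarith : (0 : ℝ) ≤ p)]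
        rw [lintegral_const_mul' _ _
          (ENNReal.rpow_ne_top_of_nonneg (by linarith) ENNReal.ofReal_ne_top)]
    _ ≤ _ := by
        refine mul_le_mul_right ?_ _
        exact (lintegral_rpow_lintegral_add_le ν hp hc.measurable).trans (by rw [measure_univ, ENNReal.one_rpow, one_mul])

/-- Triangle inequality for z̄f = f' - (f' - z̄f), since |z̄| = |z|. -/
theorem weightedNorm_one_le {f : ℂ → ℂ} (hf : Differentiable ℂ f) :
    weightedNorm p 1 f
      ≤ weightedNorm p 0 (deriv f) + ENNReal.ofReal (Real.exp (1 / 2)) * weightedNorm p 0 f := by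
  have hd : Continuous (deriv f) := hf.contDiff.continuous_deriv (n := 1) le_rfl
  have h1 : weightedNorm p 1 f = weightedNorm p 0 (fun z => deriv f z +
      (-1) * (deriv f z - conj z * f z)) := by
    rw [weightedNorm, weightedNorm]
    refine eLpNorm_congr_norm_ae (ae_of_all _ fun v => ?_)
    rw [show deriv f v + (-1) * (deriv f v - conj v * f v) = conj v * f v by ring]
    simp [fockWeight]; ring
  have hc := hf.continuous
  rw [h1]
  refine (weightedNorm_add_le hd.aestronglyMeasurable ?_).trans ?_
  · exact Continuous.aestronglyMeasurable (by fun_prop)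
  · rw [weightedNorm_const_mul]
    rw [enorm_neg, enorm_one, one_mul]
    exact add_le_add_right (weightedNorm_deriv_sub_le hf) _

/-- The weighted norm with weight `|z|^n` is controlled by the Fock norms of the derivatives. -/
theorem exists_weightedNorm_le_sum_iteratedDeriv (n : ℕ) :
    ∃ C : ℝ≥0, ∀ f : ℂ → ℂ, Differentiable ℂ f →
      weightedNorm p n f ≤ C * ∑ k ∈ Finset.range (n + 1), weightedNorm p 0 (iteratedDeriv k f) := by
  -- Weight n + 1 on f is weight 1 on z^n f, whose derivative involves the weights n and n - 1;
  -- hence strong induction.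
  induction n using Nat.strong_induction_on with
  | _ n ih =>
  rcases n with _ | n
  · exact ⟨1, fun f _ => by simp⟩
  obtain ⟨C, hC⟩ := ih n (Nat.lt_succ_self n)
  -- For n = 0 the truncated n - 1 is harmless: the term it bounds carries the coefficient n.
  obtain ⟨D, hD⟩ := ih (n - 1) (by omega)
  refine ⟨n * D + C + Real.toNNReal (Real.exp (1 / 2)) * C, fun f hf => ?_⟩
  set S := ∑ k ∈ Finset.range (n + 1 + 1), weightedNorm p 0 (iteratedDeriv k f) with hS
  have hf' : Differentiable ℂ (deriv f) := hf.deriv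
  have hfc := hf.continuous
  have hfc' := hf'.continuous
  have e1 : weightedNorm p n f ≤ C * S := (hC f hf).trans <| by
    gcongr; exact Finset.sum_le_sum_of_subset (by simp)
  have e2 : weightedNorm p (n - 1) f ≤ D * S := (hD f hf).trans <| by
    gcongr; exact Finset.sum_le_sum_of_subset (by simp; omega)
  have e3 : weightedNorm p n (deriv f) ≤ C * S := (hC _ hf').trans <| by
    gcongr
    rw [hS, Finset.sum_range_succ' _ (n + 1)]
    simp only [iteratedDeriv_succ']
    exact le_self_add
  have h0 := weightedNorm_pow_mul (p := p) (m := 0) n f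
  rw [zero_add] at h0
  have h1 : weightedNorm p (n + 1) f = weightedNorm p 1 (fun v => v ^ n * f v) := by
    rw [weightedNorm_pow_mul, add_comm]
  have hd : deriv (fun v => v ^ n * f v)
      = fun v => (n : ℂ) * (v ^ (n - 1) * f v) + v ^ n * deriv f v := by
    ext v
    rw [HasDerivAt.deriv (f := fun v => v ^ n * f v)
      ((hasDerivAt_pow n v).mul (hf v).hasDerivAt)]
    ring
  have h2 : weightedNorm p 0 (deriv (fun v => v ^ n * f v))
      ≤ n * weightedNorm p (n - 1) f + weightedNorm p n (deriv f) := by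
    rw [hd]
    refine (weightedNorm_add_le ?_ ?_).trans ?_
    · exact Continuous.aestronglyMeasurable (by fun_prop)
    · exact Continuous.aestronglyMeasurable (by fun_prop)
    · rw [weightedNorm_const_mul, weightedNorm_pow_mul, weightedNorm_pow_mul, zero_add, zero_add]
      gcongr
      rw [← ofReal_norm]; simp
  rw [h1]
  refine (weightedNorm_one_le ((differentiable_id.pow n).mul hf)).trans ?_
  have h3 : weightedNorm p 0 ((id ^ n) * f) = weightedNorm p n f := h0
  refine (add_le_add h2 (le_of_eq (congrArg _ h3))).trans ?_
  push_cast
  rw [add_mul, add_mul, mul_assoc, mul_assoc]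
  gcongr
  exact le_rfl

/-- The two sides are proportional: the Fock norm carries the normalizing factor ω_{p,0}^{1/p},
which is positive and finite. -/
theorem exists_sum_weightedNorm_le_enorm (m : ℕ) :
    ∃ C : ℝ≥0, ∀ f : FockSobolev p m,
      ∑ k ∈ Finset.range (m + 1), weightedNorm p 0 (iteratedDeriv k f) ≤ C * ‖f‖ₑ := by
  have hp := one_le_toReal_of_fact p
  set κ : ℝ≥0∞ := ENNReal.ofReal (fockOmega p 0) ^ (1 / (p : ℝ)) with hκ
  have hκ0 : κ ≠ 0 := by
    rw [hκ]; simp [ENNReal.rpow_eq_zero_iff, fockOmega_pos]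
  have hκt : κ ≠ ∞ := ENNReal.rpow_ne_top_of_nonneg (by positivity) ENNReal.ofReal_ne_top
  refine ⟨κ⁻¹.toNNReal, fun f => ?_⟩
  rw [ENNReal.coe_toNNReal (ENNReal.inv_ne_top.2 hκ0), ← ofReal_norm, FockSobolev.norm_def,
    ENNReal.ofReal_sum_of_nonneg (f := fun k => fockNorm p (iteratedDeriv k f))
    (fun _ _ => ENNReal.toReal_nonneg), Finset.mul_sum]
  refine Finset.sum_le_sum fun k hk => ?_
  have := (f.memLp (Nat.lt_succ_iff.1 (Finset.mem_range.1 hk))).2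
  rw [fockNorm, ENNReal.ofReal_toReal this.ne, eLpNorm_fockMeasure, ← mul_assoc,
    ENNReal.inv_mul_cancel hκ0 hκt, one_mul]

/-- The embedding of the Fock-Sobolev space into the weighted Lebesgue space. -/
theorem exists_weightedNorm_le_enorm (m : ℕ) :
    ∃ C : ℝ≥0, ∀ f : FockSobolev p m, weightedNorm p m f ≤ C * ‖f‖ₑ := by
  obtain ⟨C, hC⟩ := exists_weightedNorm_le_sum_iteratedDeriv (p := p) m
  obtain ⟨D, hD⟩ := exists_sum_weightedNorm_le_enorm (p := p) m
  refine ⟨C * D, fun f => (hC f f.differentiable).trans ?_⟩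
  rw [ENNReal.coe_mul, mul_assoc]
  exact mul_le_mul_right (hD f) _

theorem weightedNorm_ne_top {m : ℕ} (f : FockSobolev p m) : weightedNorm p m f ≠ ∞ := by
  obtain ⟨C, hC⟩ := exists_weightedNorm_le_enorm (p := p) m
  exact ne_top_of_le_ne_top (ENNReal.mul_ne_top ENNReal.coe_ne_top enorm_ne_top) (hC f)

/-- Point evaluations are uniformly bounded on compact sets. -/
theorem exists_norm_apply_le (m : ℕ) (R : ℝ) :
    ∃ C : ℝ≥0, ∀ (f : FockSobolev p m) (z : ℂ), ‖z‖ ≤ R → ‖f z‖ ≤ C * ‖f‖ := by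
  have hp := one_le_toReal_of_fact p
  obtain ⟨C, hC⟩ := exists_weightedAbs_rpow_le_setLIntegral (p := p) one_pos
  obtain ⟨D, hD⟩ := exists_sum_weightedNorm_le_enorm (p := p) m
  refine ⟨C ^ (1 / (p : ℝ)) * D * Real.toNNReal (Real.exp (R ^ 2 / 2)), fun f z hz => ?_⟩
  have h1 : weightedNorm p 0 f ≤ D * ‖f‖ₑ := by
    refine le_trans ?_ (hD f)
    rw [Finset.sum_range_succ', iteratedDeriv_zero]
    exact le_add_self
  have h2 : weightedAbs 0 f z ≤ (C : ℝ≥0∞) ^ (1 / (p : ℝ)) * weightedNorm p 0 f := by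
    rw [← ENNReal.rpow_le_rpow_iff (z := (p : ℝ)) (by linarith),
      ENNReal.mul_rpow_of_nonneg _ _ (by linarith), weightedNorm_rpow, ← ENNReal.rpow_mul,
      one_div_mul_cancel (by linarith), ENNReal.rpow_one]
    refine (hC f f.differentiable z).trans ?_
    gcongr
    exact Measure.restrict_le_self
  have h3 : ‖f z‖ₑ ≤ ENNReal.ofReal (Real.exp (R ^ 2 / 2)) * weightedAbs 0 f z := by
    rw [weightedAbs_eq, ← mul_assoc, ← ENNReal.ofReal_mul (by positivity)]
    refine le_mul_of_one_le_left zero_le ?_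
    rw [ENNReal.one_le_ofReal, fockWeight, pow_zero, one_mul, ← Real.exp_add, Real.one_le_exp_iff]
    have := pow_le_pow_left₀ (norm_nonneg z) hz 2
    linarith
  have h4 : ‖f z‖ₑ ≤ ((C ^ (1 / (p : ℝ)) * D * Real.toNNReal (Real.exp (R ^ 2 / 2)) : ℝ≥0) : ℝ≥0∞)
      * ‖f‖ₑ := by
    calc ‖f z‖ₑ ≤ ENNReal.ofReal (Real.exp (R ^ 2 / 2)) *
          ((C : ℝ≥0∞) ^ (1 / (p : ℝ)) * (D * ‖f‖ₑ)) := by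
          refine h3.trans ?_
          gcongr
          exact h2.trans (by gcongr)
      _ = _ := by
          rw [ENNReal.coe_mul, ENNReal.coe_mul, ← ENNReal.coe_rpow_of_nonneg _ (by positivity)]
          simp only [ENNReal.ofReal]
          ring
  rw [enorm_eq_nnnorm, enorm_eq_nnnorm, ← ENNReal.coe_mul, ENNReal.coe_le_coe] at h4
  exact_mod_cast h4

end embedding

/-! ### The reproducing kernel -/

section kernel

/-- Because k! m! divides (k + m)!; it makes the kernel series dominated by the exponential series.
-/
theorem norm_factorial_div_mul_pow_le (m : ℕ) (w : ℂ) (k : ℕ) :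
    ‖((m.factorial : ℂ) / ((k + m).factorial : ℂ)) * w ^ k‖ ≤ ‖w‖ ^ k / k.factorial := by
  have h1 : (k.factorial * m.factorial : ℝ) ≤ (k + m).factorial := by
    exact_mod_cast Nat.le_of_dvd (Nat.factorial_pos _) (Nat.factorial_mul_factorial_dvd_factorial_add k m)
  have h2 : (0 : ℝ) < k.factorial := by exact_mod_cast k.factorial_pos
  have h3 : (0 : ℝ) < (k + m).factorial := by exact_mod_cast (k + m).factorial_pos
  rw [norm_mul, norm_div, norm_pow, Complex.norm_natCast, Complex.norm_natCast, div_mul_eq_mul_div,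
    div_le_div_iff₀ h3 h2]
  nlinarith [mul_le_mul_of_nonneg_left h1 (by positivity : 0 ≤ ‖w‖ ^ k)]

theorem hasSum_pow_div_factorial (x : ℝ) :
    HasSum (fun k : ℕ => x ^ k / k.factorial) (Real.exp x) := by
  rw [Real.exp_eq_exp_ℝ]
  exact NormedSpace.expSeries_div_hasSum_exp x

theorem hasSum_fockKernel (m : ℕ) (v z : ℂ) :
    HasSum (fun k : ℕ => ((m.factorial : ℂ) / ((k + m).factorial : ℂ)) * (conj z * v) ^ k)
      (fockKernel m v z) :=
  ((hasSum_pow_div_factorial ‖conj z * v‖).summable.of_norm_bounded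
    fun k => norm_factorial_div_mul_pow_le m (conj z * v) k).hasSum

theorem norm_fockKernel_le (m : ℕ) (v z : ℂ) : ‖fockKernel m v z‖ ≤ Real.exp (‖z‖ * ‖v‖) := by
  have := tsum_of_norm_bounded (hasSum_pow_div_factorial ‖conj z * v‖)
    (fun k => norm_factorial_div_mul_pow_le m (conj z * v) k)
  simpa [fockKernel] using this

theorem measurable_fockKernel (m : ℕ) : Measurable fun q : ℂ × ℂ => fockKernel m q.1 q.2 := by
  refine measurable_of_tendsto_metrizable (f := fun n (q : ℂ × ℂ) => ∑ k ∈ Finset.range n,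
    ((m.factorial : ℂ) / ((k + m).factorial : ℂ)) * (conj q.2 * q.1) ^ k) (fun n => ?_)
    (tendsto_pi_nhds.2 fun q => (hasSum_fockKernel m q.1 q.2).tendsto_sum_nat)
  exact Continuous.measurable (by fun_prop)

/-- Multiplication by (z̄v)^m shifts the index, so the kernel becomes a tail of the exponential
series. The factor is available from the weights |z|^m |v|^m. -/
theorem pow_mul_fockKernel (m : ℕ) (v z : ℂ) :
    (conj z * v) ^ m * fockKernel m v z = m.factorial *
      (Complex.exp (conj z * v) - ∑ j ∈ Finset.range m, (conj z * v) ^ j / j.factorial) := by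
  set w := conj z * v
  have h1 : HasSum (fun k : ℕ => w ^ k / (k.factorial : ℂ)) (Complex.exp w) := by
    rw [Complex.exp_eq_exp_ℂ]
    exact NormedSpace.expSeries_div_hasSum_exp w
  have h2 := ((hasSum_nat_add_iff' m).2 h1).mul_left (m.factorial : ℂ)
  refine ((hasSum_fockKernel m v z).mul_left (w ^ m)).unique ?_
  convert h2 using 2 with k
  rw [pow_add]
  ring

/-- Each term is 2^j (s/2)^j / j!. Spending only e^{s/2} leaves a factor e^{-s/2} of the Gaussian
weight for the off-diagonal decay. -/
theorem sum_range_pow_div_factorial_le (m : ℕ) {s : ℝ} (hs : 0 ≤ s) :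
    ∑ j ∈ Finset.range m, s ^ j / j.factorial ≤ 2 ^ m * Real.exp (s / 2) := by
  have h : ∀ j ∈ Finset.range m, s ^ j / j.factorial ≤ 2 ^ j * Real.exp (s / 2) := by
    intro j _
    have := Real.pow_div_factorial_le_exp (s / 2) (by positivity) j
    calc s ^ j / j.factorial = 2 ^ j * ((s / 2) ^ j / j.factorial) := by
          rw [div_pow]; field_simp
      _ ≤ _ := by gcongr
  refine (Finset.sum_le_sum h).trans ?_
  rw [← Finset.sum_mul]
  gcongr
  have : ∑ j ∈ Finset.range m, (2 : ℝ) ^ j = 2 ^ m - 1 := by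
    have := geom_sum_eq (by norm_num : (2 : ℝ) ≠ 1) m
    rw [this]; norm_num
  linarith

/-- Gaussian off-diagonal decay of the weighted reproducing kernel. -/
theorem fockWeight_mul_norm_fockKernel_mul_fockWeight_le (m : ℕ) (v z : ℂ) :
    fockWeight m z * ‖fockKernel m v z‖ * fockWeight m v
      ≤ m.factorial * (1 + 2 ^ m) * Real.exp (-‖z - v‖ ^ 2 / 8) := by
  set w := conj z * v with hw
  set s := (‖z‖ ^ 2 + ‖v‖ ^ 2) / 2 with hs
  have hnw : ‖w‖ = ‖z‖ * ‖v‖ := by simp [hw]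
  have hws : ‖w‖ ≤ s := by rw [hnw, hs]; nlinarith [sq_nonneg (‖z‖ - ‖v‖)]
  have hzv : ‖z - v‖ ^ 2 ≤ 4 * s := by
    have := norm_sub_le z v
    have := pow_le_pow_left₀ (norm_nonneg _) this 2
    rw [hs]; nlinarith [sq_nonneg (‖z‖ - ‖v‖)]
  -- The exponential part of the kernel carries exactly the Gaussian e^{-|z-v|²/2}; the exponent 1/8
  -- is forced only by the Taylor polynomial, through |z - v|² ≤ 4s.
  have hre : w.re - s = -‖z - v‖ ^ 2 / 2 := by
    rw [hs]
    simp only [← Complex.normSq_eq_norm_sq, Complex.normSq_apply]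
    simp [hw]
    ring
  have h1 : fockWeight m z * ‖fockKernel m v z‖ * fockWeight m v
      = ‖w ^ m * fockKernel m v z‖ * Real.exp (-s) := by
    rw [norm_mul, norm_pow, hnw, mul_pow, fockWeight, fockWeight, hs,
      show -((‖z‖ ^ 2 + ‖v‖ ^ 2) / 2) = -‖z‖ ^ 2 / 2 + -‖v‖ ^ 2 / 2 by ring, Real.exp_add]
    ring
  have h2 : ‖∑ j ∈ Finset.range m, w ^ j / j.factorial‖ ≤ 2 ^ m * Real.exp (s / 2) := by
    refine le_trans ((norm_sum_le _ _).trans (Finset.sum_le_sum fun j _ => ?_))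
      (sum_range_pow_div_factorial_le m ((norm_nonneg w).trans hws))
    rw [norm_div, norm_pow, Complex.norm_natCast]
    gcongr
  have h3 : ‖Complex.exp w‖ * Real.exp (-s) ≤ Real.exp (-‖z - v‖ ^ 2 / 8) := by
    rw [Complex.norm_exp, ← Real.exp_add, Real.exp_le_exp]
    have := sq_nonneg ‖z - v‖
    linarith
  have h4 : Real.exp (s / 2) * Real.exp (-s) ≤ Real.exp (-‖z - v‖ ^ 2 / 8) := by
    rw [← Real.exp_add, Real.exp_le_exp]
    linarith
  rw [h1, pow_mul_fockKernel, norm_mul, Complex.norm_natCast, mul_assoc, mul_assoc]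
  refine mul_le_mul_of_nonneg_left ?_ (Nat.cast_nonneg _)
  calc _ ≤ (‖Complex.exp w‖ + 2 ^ m * Real.exp (s / 2)) * Real.exp (-s) := by
        gcongr; exact (norm_sub_le _ _).trans (add_le_add le_rfl h2)
    _ = ‖Complex.exp w‖ * Real.exp (-s) + 2 ^ m * (Real.exp (s / 2) * Real.exp (-s)) := by ring
    _ ≤ Real.exp (-‖z - v‖ ^ 2 / 8) + 2 ^ m * Real.exp (-‖z - v‖ ^ 2 / 8) := by gcongr
    _ = _ := by ring

theorem integrable_exp_neg_mul_norm_sq {b : ℝ} (hb : 0 < b) :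
    Integrable fun v : ℂ => Real.exp (-b * ‖v‖ ^ 2) := by
  have := (GaussianFourier.integrable_cexp_neg_mul_sq_norm_add (V := ℂ) (b := (b : ℂ))
    (by simpa using hb) 0 0).norm
  refine this.congr (ae_of_all _ fun v => ?_)
  simp only [Complex.norm_exp]
  congr 1
  simp [← Complex.ofReal_pow]

end kernel

/-! ### The projection: convergence, reproduction, boundedness -/

section projection

/-- Functions of moderate growth, for which the integral defining the projection converges. -/
def FockIntegrable (m : ℕ) (h : ℂ → ℂ) : Prop :=
  AEStronglyMeasurable h volume ∧
    Integrable fun v => ‖h v‖ * fockWeight m v * Real.exp (-‖v‖ ^ 2 / 4)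

theorem fockWeight_sq (m : ℕ) (v : ℂ) :
    ‖v‖ ^ (2 * m) * Real.exp (-‖v‖ ^ 2) = fockWeight m v ^ 2 := by
  rw [fockWeight, mul_pow, ← Real.exp_nat_mul, ← pow_mul, mul_comm m 2]
  congr 2; push_cast; ring

theorem norm_projIntegrand (m : ℕ) (h : ℂ → ℂ) (z v : ℂ) :
    ‖projIntegrand m h z v‖ = ‖h v‖ * ‖fockKernel m v z‖ * fockWeight m v ^ 2 := by
  rw [projIntegrand, fockWeight_sq, norm_mul, norm_mul, RCLike.norm_conj, Complex.norm_real,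
    Real.norm_of_nonneg (sq_nonneg _)]

/-- One weight factor absorbs e^{|z||v|} and still leaves e^{-|v|²/4}. The resulting majorant serves
both for the convergence of the projection and for integrating the kernel series termwise. -/
theorem FockIntegrable.integrable_exp_mul {m : ℕ} {h : ℂ → ℂ} (hh : FockIntegrable m h) (z : ℂ) :
    Integrable fun v => ‖h v‖ * Real.exp (‖z‖ * ‖v‖) * fockWeight m v ^ 2 := by
  refine (hh.2.const_mul (m.factorial * Real.exp ((1 + ‖z‖) ^ 2))).mono' ?_
    (ae_of_all _ fun v => ?_)
  · exact (hh.1.norm.mul (by fun_prop : Continuous fun v : ℂ =>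
      Real.exp (‖z‖ * ‖v‖)).aestronglyMeasurable).mul
      ((continuous_fockWeight m).pow 2).aestronglyMeasurable
  · have hw := fockWeight_nonneg m v
    rw [Real.norm_of_nonneg (by positivity)]
    have h1 : ‖v‖ ^ m ≤ m.factorial * Real.exp ‖v‖ := by
      have := Real.pow_div_factorial_le_exp ‖v‖ (norm_nonneg v) m
      rwa [div_le_iff₀ (by exact_mod_cast m.factorial_pos), mul_comm] at this
    have h2 : Real.exp (‖z‖ * ‖v‖) * fockWeight m v
        ≤ m.factorial * Real.exp ((1 + ‖z‖) ^ 2) * Real.exp (-‖v‖ ^ 2 / 4) := by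
      calc Real.exp (‖z‖ * ‖v‖) * fockWeight m v
          ≤ Real.exp (‖z‖ * ‖v‖) * ((m.factorial * Real.exp ‖v‖) * Real.exp (-‖v‖ ^ 2 / 2)) := by
            unfold fockWeight; gcongr
        _ = m.factorial * Real.exp (‖z‖ * ‖v‖ + ‖v‖ + -‖v‖ ^ 2 / 2) := by
            rw [Real.exp_add, Real.exp_add]; ring
        _ ≤ m.factorial * Real.exp ((1 + ‖z‖) ^ 2 + -‖v‖ ^ 2 / 4) := by
            refine mul_le_mul_of_nonneg_left (Real.exp_le_exp.2 ?_) (Nat.cast_nonneg _)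
            -- Completing the square: (1+|z|)|v| - |v|²/2 ≤ (1+|z|)² - |v|²/4.
            nlinarith [sq_nonneg ((1 + ‖z‖) - ‖v‖ / 2)]
        _ = _ := by rw [Real.exp_add]; ring
    calc ‖h v‖ * Real.exp (‖z‖ * ‖v‖) * fockWeight m v ^ 2
        = ‖h v‖ * fockWeight m v * (Real.exp (‖z‖ * ‖v‖) * fockWeight m v) := by ring
      _ ≤ ‖h v‖ * fockWeight m v *
          (m.factorial * Real.exp ((1 + ‖z‖) ^ 2) * Real.exp (-‖v‖ ^ 2 / 4)) := by gcongr
      _ = _ := by ring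

theorem aestronglyMeasurable_projIntegrand {m : ℕ} {h : ℂ → ℂ}
    (hh : AEStronglyMeasurable h volume) (z : ℂ) :
    AEStronglyMeasurable (projIntegrand m h z) volume := by
  unfold projIntegrand
  have h0 : Measurable fun v => fockKernel m v z :=
    Measurable.comp (g := fun q : ℂ × ℂ => fockKernel m q.1 q.2) (f := fun v => (v, z))
      (measurable_fockKernel m) measurable_prodMk_right
  have h1 : Measurable fun v => conj (fockKernel m v z) :=
    Complex.continuous_conj.measurable.comp h0
  exact (hh.mul h1.aestronglyMeasurable).mul (Continuous.aestronglyMeasurable (by fun_prop))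

theorem FockIntegrable.integrable_projIntegrand {m : ℕ} {h : ℂ → ℂ} (hh : FockIntegrable m h)
    (z : ℂ) : Integrable (projIntegrand m h z) := by
  refine (hh.integrable_exp_mul z).mono' (aestronglyMeasurable_projIntegrand hh.1 z)
    (ae_of_all _ fun v => ?_)
  rw [norm_projIntegrand]
  gcongr
  exact norm_fockKernel_le m v z

/-- The kernel integral reproduces entire functions of moderate growth. -/
theorem fockProj_eq_self {m : ℕ} {f : ℂ → ℂ} (hf : Differentiable ℂ f) (hfi : FockIntegrable m f)
    (z : ℂ) : fockProj m f z = f z := by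
  set c : ℕ → ℂ := fun k => (m.factorial : ℂ) / ((k + m).factorial : ℂ) with hc
  set a : ℕ → ℂ := fun k => (k.factorial : ℂ)⁻¹ * iteratedDeriv k f 0 with ha
  set φ : ℕ → ℂ → ℂ := fun k v =>
    f v * conj (c k * (conj z * v) ^ k) * ((fockWeight m v ^ 2 : ℝ) : ℂ) with hφ
  have hw2 : Continuous fun v => ((fockWeight m v ^ 2 : ℝ) : ℂ) := by fun_prop
  have hfc := hf.continuous
  have hφc (k : ℕ) : Continuous (φ k) := by
    simp only [hφ]; fun_prop
  have hbd : ∀ k v, ‖φ k v‖ ≤ (‖z‖ * ‖v‖) ^ k / k.factorial * (‖f v‖ * fockWeight m v ^ 2) := by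
    intro k v
    have := norm_factorial_div_mul_pow_le m (conj z * v) k
    simp only [norm_mul, RCLike.norm_conj, hφ] at this ⊢
    rw [Complex.norm_real, Real.norm_of_nonneg (sq_nonneg _)]
    calc _ = (‖c k‖ * ‖(conj z * v) ^ k‖) * (‖f v‖ * fockWeight m v ^ 2) := by ring
      _ ≤ _ := by gcongr
  have hsb (v : ℂ) : HasSum (fun k : ℕ => (‖z‖ * ‖v‖) ^ k / k.factorial *
      (‖f v‖ * fockWeight m v ^ 2)) (‖f v‖ * Real.exp (‖z‖ * ‖v‖) * fockWeight m v ^ 2) := by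
    rw [mul_comm ‖f v‖ (Real.exp _), mul_assoc (Real.exp _)]
    exact (hasSum_pow_div_factorial (‖z‖ * ‖v‖)).mul_right _
  have hsum : HasSum (fun k => ∫ v, φ k v) (∫ v, projIntegrand m f z v) := by
    refine hasSum_integral_of_dominated_convergence (fun k v => (‖z‖ * ‖v‖) ^ k / k.factorial *
      (‖f v‖ * fockWeight m v ^ 2)) (fun k => (hφc k).aestronglyMeasurable)
      (fun k => ae_of_all _ (hbd k)) (ae_of_all _ fun v => (hsb v).summable) ?_
      (ae_of_all _ fun v => ?_)
    · simp_rw [fun v => (hsb v).tsum_eq]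
      exact hfi.integrable_exp_mul z
    · have := ((hasSum_fockKernel m v z).map (starRingEnd ℂ) Complex.continuous_conj)
      rw [projIntegrand, fockWeight_sq]
      exact (this.mul_left (f v)).mul_right _
  have hφi (k : ℕ) : Integrable (φ k) :=
    (hfi.integrable_exp_mul z).mono' (hφc k).aestronglyMeasurable
      (ae_of_all _ fun v => (hbd k v).trans
        (le_hasSum (hsb v) k fun j _ => by positivity))
  -- The angular mean keeps only the k-th Taylor coefficient of f; the radial integral is π (k+m)!,
  -- which cancels the denominator of c k and leaves π m! for every k.
  have hφint (k : ℕ) : ∫ v, φ k v = (Real.pi * m.factorial : ℝ) * (a k * z ^ k) := by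
    rw [integral_eq_integral_angle (hφi k)]
    have h1 (v : ℂ) : ∫ θ, φ k (unitPt θ * v) ∂angleMeasure
        = c k * z ^ k * a k * ((‖v‖ ^ ((2 * (k + m) : ℕ) : ℝ) * Real.exp (-‖v‖ ^ (2 : ℝ)) : ℝ) : ℂ) := by
      have h2 (θ : ℝ) : φ k (unitPt θ * v) = (c k * z ^ k * conj v ^ k *
          ((fockWeight m v ^ 2 : ℝ) : ℂ)) * (f (unitPt θ * v) * conj (unitPt θ) ^ k) := by
        have h3 : fockWeight m (unitPt θ * v) = fockWeight m v := by simp [fockWeight]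
        have h4 : conj (c k) = c k := by simp [hc]
        simp only [hφ, h3, map_mul, map_pow, Complex.conj_conj, h4]
        ring
      simp_rw [h2]
      rw [integral_const_mul, integral_unitPt_mul hf k v, ← fockWeight_sq]
      have h5 : ((‖v‖ : ℝ) : ℂ) ^ (2 * k) = conj v ^ k * v ^ k := by
        rw [← mul_pow, mul_comm (conj v), Complex.mul_conj, Complex.normSq_eq_norm_sq, pow_mul]
        push_cast; rfl
      rw [Real.rpow_natCast, Real.rpow_two, mul_add, pow_add]
      push_cast
      rw [h5]
      ring
    simp_rw [h1]
    rw [integral_const_mul, integral_complex_ofReal,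
      Complex.integral_rpow_mul_exp_neg_rpow (by norm_num) (by
        have : (0 : ℝ) ≤ ((2 * (k + m) : ℕ) : ℝ) := Nat.cast_nonneg _
        linarith)]
    rw [show ((((2 * (k + m) : ℕ) : ℝ) + 2) / 2) = ((k + m : ℕ) : ℝ) + 1 by push_cast; ring,
      Real.Gamma_nat_eq_factorial, hc]
    have : ((k + m).factorial : ℂ) ≠ 0 := by exact_mod_cast (k + m).factorial_ne_zero
    push_cast
    field_simp
  have hT : HasSum (fun k => a k * z ^ k) (f z) := by
    have := Complex.hasSum_taylorSeries_of_entire hf 0 z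
    have h6 (k : ℕ) : a k * z ^ k = (k.factorial : ℂ)⁻¹ • (z - 0) ^ k • iteratedDeriv k f 0 := by
      simp only [ha, smul_eq_mul, sub_zero]
      ring
    simpa only [h6] using this
  have hm : ((Real.pi * m.factorial : ℝ) : ℂ) ≠ 0 := by
    exact_mod_cast (by positivity : Real.pi * (m.factorial : ℝ) ≠ 0)
  simp_rw [hφint] at hsum
  rw [fockProj, hsum.unique (hT.mul_left _), ← mul_assoc, one_div, Complex.ofReal_inv,
    inv_mul_cancel₀ hm, one_mul]

theorem fockProj_congr {m : ℕ} {h k : ℂ → ℂ} (H : h =ᵐ[volume] k) :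
    fockProj m h = fockProj m k := by
  ext z
  unfold fockProj
  congr 1
  refine integral_congr_ae (H.mono fun v hv => ?_)
  simp only [projIntegrand, hv]

theorem fockProj_add {m : ℕ} {h k : ℂ → ℂ} (hh : FockIntegrable m h) (hk : FockIntegrable m k)
    (z : ℂ) : fockProj m (fun v => h v + k v) z = fockProj m h z + fockProj m k z := by
  unfold fockProj
  rw [← mul_add, ← integral_add (hh.integrable_projIntegrand z) (hk.integrable_projIntegrand z)]
  congr 1
  refine integral_congr_ae (ae_of_all _ fun v => ?_)
  simp only [projIntegrand]
  ring

theorem fockProj_const_mul {m : ℕ} (c : ℂ) (h : ℂ → ℂ) (z : ℂ) :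
    fockProj m (fun v => c * h v) z = c * fockProj m h z := by
  unfold fockProj
  have (v : ℂ) : projIntegrand m (fun v => c * h v) z v = c * projIntegrand m h z v := by
    simp only [projIntegrand]
    ring
  simp_rw [this]
  rw [integral_const_mul, mul_left_comm]

theorem aestronglyMeasurable_fockProj {m : ℕ} {h : ℂ → ℂ} (hh : AEStronglyMeasurable h volume) :
    AEStronglyMeasurable (fockProj m h) volume := by
  rw [fockProj_congr hh.ae_eq_mk]
  unfold fockProj
  refine (StronglyMeasurable.const_mul ?_ _).aestronglyMeasurable
  refine StronglyMeasurable.integral_prod_right (f := fun z v => projIntegrand m (hh.mk h) z v) ?_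
  have h0 : Measurable fun q : ℂ × ℂ => fockKernel m q.2 q.1 :=
    Measurable.comp (g := fun q : ℂ × ℂ => fockKernel m q.1 q.2) (f := Prod.swap)
      (measurable_fockKernel m) measurable_swap
  have h1 : Measurable fun q : ℂ × ℂ => conj (fockKernel m q.2 q.1) :=
    Complex.continuous_conj.measurable.comp h0
  have h2 : Measurable fun q : ℂ × ℂ => hh.mk h q.2 :=
    hh.stronglyMeasurable_mk.measurable.comp measurable_snd
  have h3 : Measurable fun q : ℂ × ℂ =>
      ((‖q.2‖ ^ (2 * m) * Real.exp (-‖q.2‖ ^ 2) : ℝ) : ℂ) :=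
    Continuous.measurable (by fun_prop)
  exact ((h2.mul h1).mul h3).stronglyMeasurable

theorem FockIntegrable.add {m : ℕ} {h k : ℂ → ℂ} (hh : FockIntegrable m h)
    (hk : FockIntegrable m k) : FockIntegrable m fun v => h v + k v := by
  refine ⟨hh.1.add hk.1, (hh.2.add hk.2).mono' ?_ (ae_of_all _ fun v => ?_)⟩
  · exact ((hh.1.add hk.1).norm.mul (continuous_fockWeight m).aestronglyMeasurable).mul
      (by fun_prop : Continuous fun v : ℂ => Real.exp (-‖v‖ ^ 2 / 4)).aestronglyMeasurable
  · have hw := fockWeight_nonneg m v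
    rw [Real.norm_of_nonneg (by positivity)]
    simp only [Pi.add_apply]
    rw [← add_mul, ← add_mul]
    gcongr
    exact norm_add_le _ _

/-- A function of linear growth times a function of finite weighted norm has moderate growth. -/
theorem fockIntegrable_mul {p : ℝ≥0} [Fact (1 ≤ (p : ℝ≥0∞))] {m : ℕ} {u h : ℂ → ℂ} {C : ℝ}
    (hum : AEStronglyMeasurable u volume) (hu : ∀ v, ‖u v‖ ≤ C * (1 + ‖v‖))
    (hhm : AEStronglyMeasurable h volume) (hh : weightedNorm p m h ≠ ∞) :
    FockIntegrable m fun v => u v * h v := by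
  have hp := one_le_toReal_of_fact p
  refine ⟨hum.mul hhm, ?_⟩
  have hw : Continuous fun v => (fockWeight m v : ℂ) := by fun_prop
  have hL : MemLp (fun v => (fockWeight m v : ℂ) * h v) p volume :=
    ⟨hw.aestronglyMeasurable.mul hhm, hh.lt_top⟩
  have hI := hL.integrable_norm_rpow coe_ne_zero_of_fact ENNReal.coe_ne_top
  have hC : 0 ≤ C := by simpa using (norm_nonneg _).trans (hu 0)
  refine (((integrable_exp_neg_mul_norm_sq (by norm_num : (0 : ℝ) < 1 / 8)).add hI).const_mul
    (C * Real.exp 2)).mono' ?_ (ae_of_all _ fun v => ?_)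
  · exact ((hum.mul hhm).norm.mul (continuous_fockWeight m).aestronglyMeasurable).mul
      (by fun_prop : Continuous fun v : ℂ => Real.exp (-‖v‖ ^ 2 / 4)).aestronglyMeasurable
  · have hw := fockWeight_nonneg m v
    rw [Real.norm_of_nonneg (by positivity)]
    simp only [Pi.add_apply, ENNReal.coe_toReal]
    rw [norm_mul (fockWeight m v : ℂ), Complex.norm_real, Real.norm_of_nonneg hw]
    set x := fockWeight m v * ‖h v‖ with hx
    have hx0 : 0 ≤ x := by positivity
    -- This replaces Hölder: the constant 1 is integrated against the remaining Gaussian and x^p is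
    -- integrable by assumption.
    have hxp : x ≤ 1 + x ^ (p : ℝ) := by
      rcases le_total x 1 with h1 | h1
      · have := Real.rpow_nonneg hx0 p; linarith
      · have := Real.rpow_le_rpow_of_exponent_le h1 hp
        rw [Real.rpow_one] at this; linarith
    -- From 1 + |v| ≤ e^{|v|} and |v| - |v|²/4 ≤ 2 - |v|²/8, which is (|v| - 4)² ≥ 0.
    have h1 : (1 + ‖v‖) * Real.exp (-‖v‖ ^ 2 / 4) ≤ Real.exp 2 * Real.exp (-(1 / 8) * ‖v‖ ^ 2) := by
      calc (1 + ‖v‖) * Real.exp (-‖v‖ ^ 2 / 4)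
          ≤ Real.exp ‖v‖ * Real.exp (-‖v‖ ^ 2 / 4) := by
            gcongr; linarith [Real.add_one_le_exp ‖v‖]
        _ ≤ _ := by
            rw [← Real.exp_add, ← Real.exp_add, Real.exp_le_exp]
            nlinarith [sq_nonneg (‖v‖ - 4)]
    have h2 : Real.exp (-(1 / 8) * ‖v‖ ^ 2) ≤ 1 := by
      rw [Real.exp_le_one_iff]; nlinarith [sq_nonneg ‖v‖]
    have h3 := Real.rpow_nonneg hx0 p
    calc ‖u v * h v‖ * fockWeight m v * Real.exp (-‖v‖ ^ 2 / 4)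
        = ‖u v‖ * Real.exp (-‖v‖ ^ 2 / 4) * x := by rw [norm_mul, hx]; ring
      _ ≤ C * (1 + ‖v‖) * Real.exp (-‖v‖ ^ 2 / 4) * x := by gcongr; exact hu v
      _ = C * ((1 + ‖v‖) * Real.exp (-‖v‖ ^ 2 / 4)) * x := by ring
      _ ≤ C * (Real.exp 2 * Real.exp (-(1 / 8) * ‖v‖ ^ 2)) * (1 + x ^ (p : ℝ)) := by gcongr
      _ = C * Real.exp 2 * (Real.exp (-(1 / 8) * ‖v‖ ^ 2) +
          Real.exp (-(1 / 8) * ‖v‖ ^ 2) * x ^ (p : ℝ)) := by ring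
      _ ≤ C * Real.exp 2 * (Real.exp (-(1 / 8) * ‖v‖ ^ 2) + 1 * x ^ (p : ℝ)) := by gcongr
      _ = _ := by rw [one_mul]

theorem fockIntegrable_of_weightedNorm_ne_top {p : ℝ≥0} [Fact (1 ≤ (p : ℝ≥0∞))] {m : ℕ}
    {h : ℂ → ℂ} (hhm : AEStronglyMeasurable h volume) (hh : weightedNorm p m h ≠ ∞) :
    FockIntegrable m h := by
  simpa using fockIntegrable_mul (u := fun _ => 1) (C := 1) aestronglyMeasurable_const
    (fun v => by simp) hhm hh

/-- A finite Gaussian measure that dominates the weighted reproducing kernel. -/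
def kernelMeasure (m : ℕ) : Measure ℂ :=
  volume.withDensity fun x =>
    ENNReal.ofReal ((1 + 2 ^ m) * Real.exp 16 / Real.pi * Real.exp (-(1 / 16) * ‖x‖ ^ 2))

instance (m : ℕ) : IsFiniteMeasure (kernelMeasure m) :=
  isFiniteMeasure_withDensity_ofReal
    ((integrable_exp_neg_mul_norm_sq (by norm_num : (0 : ℝ) < 1 / 16)).const_mul _).2

/-- The Gaussian decay of the kernel absorbs the quadratic factor. The point z is fixed, so the
multiplier u may depend on it; this admits u = b(z) - b. -/
theorem enorm_fockWeight_mul_fockProj_le {m : ℕ} {u h : ℂ → ℂ} {ε : ℝ} {z : ℂ}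
    (hu : ∀ v, ‖u v‖ ≤ ε * (1 + ‖z - v‖) ^ 2) :
    weightedAbs m (fockProj m fun v => u v * h v) z
      ≤ ENNReal.ofReal ε * ∫⁻ x, weightedAbs m h (z + x) ∂kernelMeasure m := by
  have hε : 0 ≤ ε := by simpa using (norm_nonneg _).trans (hu z)
  set D : ℂ → ℝ := fun x => (1 + 2 ^ m) * Real.exp 16 / Real.pi * Real.exp (-(1 / 16) * ‖x‖ ^ 2)
    with hD
  have hpt (v : ℂ) : ‖((fockWeight m z : ℂ) * ((1 / (Real.pi * (m.factorial : ℝ)) : ℝ) : ℂ)) *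
      projIntegrand m (fun v => u v * h v) z v‖ₑ
      ≤ ENNReal.ofReal ε * (ENNReal.ofReal (D (v - z)) * weightedAbs m h v) := by
    rw [weightedAbs, ← ofReal_norm, ← ofReal_norm,
      ← ENNReal.ofReal_mul (by positivity), ← ENNReal.ofReal_mul hε]
    refine ENNReal.ofReal_le_ofReal ?_
    have hwz := fockWeight_nonneg m z
    have hwv := fockWeight_nonneg m v
    have hmf : (0 : ℝ) < m.factorial := by exact_mod_cast m.factorial_pos
    rw [norm_mul, norm_mul, norm_mul, norm_projIntegrand, norm_mul, Complex.norm_real,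
      Complex.norm_real, Complex.norm_real, Real.norm_of_nonneg hwz, Real.norm_of_nonneg hwv,
      Real.norm_of_nonneg (by positivity)]
    have hk := fockWeight_mul_norm_fockKernel_mul_fockWeight_le m v z
    set t := ‖z - v‖ with ht
    have ht0 : 0 ≤ t := norm_nonneg _
    -- Source of the constants in `kernelMeasure`: (1+t)² ≤ e^{2t}, and 2t - t²/8 ≤ 16 - t²/16
    -- because (t - 16)² ≥ 0.
    have h1 : (1 + t) ^ 2 * Real.exp (-t ^ 2 / 8)
        ≤ Real.exp 16 * Real.exp (-(1 / 16) * t ^ 2) := by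
      calc (1 + t) ^ 2 * Real.exp (-t ^ 2 / 8)
          ≤ Real.exp t ^ 2 * Real.exp (-t ^ 2 / 8) := by
            gcongr; linarith [Real.add_one_le_exp t]
        _ ≤ _ := by
            rw [← Real.exp_nat_mul, ← Real.exp_add, ← Real.exp_add, Real.exp_le_exp]
            push_cast
            nlinarith [sq_nonneg (t - 16)]
    calc _ = ‖u v‖ * (fockWeight m z * ‖fockKernel m v z‖ * fockWeight m v) *
          (1 / (Real.pi * m.factorial)) * (fockWeight m v * ‖h v‖) := by ring
      _ ≤ (ε * (1 + t) ^ 2) * (m.factorial * (1 + 2 ^ m) * Real.exp (-t ^ 2 / 8)) *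
          (1 / (Real.pi * m.factorial)) * (fockWeight m v * ‖h v‖) := by
          gcongr; exact hu v
      _ = ε * ((1 + 2 ^ m) / Real.pi * ((1 + t) ^ 2 * Real.exp (-t ^ 2 / 8))) *
          (fockWeight m v * ‖h v‖) := by field_simp
      _ ≤ ε * ((1 + 2 ^ m) / Real.pi * (Real.exp 16 * Real.exp (-(1 / 16) * t ^ 2))) *
          (fockWeight m v * ‖h v‖) := by gcongr
      _ = _ := by rw [hD]; simp only [norm_sub_rev v z, ← ht]; ring
  rw [weightedAbs, fockProj, ← mul_assoc, ← integral_const_mul]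
  refine (enorm_integral_le_lintegral_enorm _).trans ((lintegral_mono hpt).trans (le_of_eq ?_))
  rw [lintegral_const_mul' _ _ ENNReal.ofReal_ne_top, ← lintegral_add_left_eq_self _ z,
    kernelMeasure, lintegral_withDensity_eq_lintegral_mul_non_measurable _ (by fun_prop)
      (ae_of_all _ fun _ => ENNReal.ofReal_lt_top)]
  congr 1
  refine lintegral_congr fun x => ?_
  simp [hD]

/-- Young's inequality for the finite measure `kernelMeasure m`. Only a pointwise bound on T is
asked for, so T need not be the projection of one function with a fixed multiplier. -/
theorem weightedNorm_le_of_le_lintegral_kernelMeasure {p : ℝ≥0} [Fact (1 ≤ (p : ℝ≥0∞))] {m : ℕ}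
    {T h : ℂ → ℂ} {ε : ℝ} (hh : Measurable h)
    (H : ∀ z, weightedAbs m T z
      ≤ ENNReal.ofReal ε * ∫⁻ x, weightedAbs m h (z + x) ∂kernelMeasure m) :
    weightedNorm p m T ≤ ENNReal.ofReal ε * kernelMeasure m univ * weightedNorm p m h := by
  have hp := one_le_toReal_of_fact p
  refine weightedNorm_le_of_lintegral_le ?_
  calc _ ≤ ∫⁻ z, (ENNReal.ofReal ε *
        ∫⁻ x, weightedAbs m h (z + x) ∂kernelMeasure m) ^ (p : ℝ) :=
        lintegral_mono fun z => ENNReal.rpow_le_rpow (H z) (by linarith)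
    _ = ENNReal.ofReal ε ^ (p : ℝ) *
        ∫⁻ z, (∫⁻ x, weightedAbs m h (z + x) ∂kernelMeasure m) ^ (p : ℝ) := by
        simp_rw [ENNReal.mul_rpow_of_nonneg _ _ (by linarith : (0 : ℝ) ≤ p)]
        rw [lintegral_const_mul' _ _
          (ENNReal.rpow_ne_top_of_nonneg (by linarith) ENNReal.ofReal_ne_top)]
    _ ≤ ENNReal.ofReal ε ^ (p : ℝ) *
        (kernelMeasure m univ ^ (p : ℝ) * ∫⁻ z, weightedAbs m h z ^ (p : ℝ)) :=
        mul_le_mul_right (lintegral_rpow_lintegral_add_le _ hp (measurable_weightedAbs m hh)) _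
    _ = _ := by rw [ENNReal.mul_rpow_of_nonneg _ _ (by linarith), mul_assoc]

/-- The case of the multiplier 1 in the preceding two estimates. -/
theorem weightedNorm_fockProj_le {p : ℝ≥0} [Fact (1 ≤ (p : ℝ≥0∞))] {m : ℕ} {h : ℂ → ℂ}
    (hh : Measurable h) :
    weightedNorm p m (fockProj m h) ≤ kernelMeasure m univ * weightedNorm p m h := by
  have := weightedNorm_le_of_le_lintegral_kernelMeasure (p := p) (T := fockProj m h) (ε := 1) hh
    fun z => by
      simpa only [one_mul] using enorm_fockWeight_mul_fockProj_le (m := m) (u := fun _ => 1)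
        (h := h) (ε := 1) (z := z) fun v => by
          rw [norm_one, one_mul]
          nlinarith [norm_nonneg (z - v)]
  simpa using this

end projection

/-! ### Operators into L^{p,m} and their compactness -/

theorem aestronglyMeasurable_fockMeasure {p : ℝ≥0} {m : ℕ} {h : ℂ → ℂ} (hh : AEStronglyMeasurable h volume) :
    AEStronglyMeasurable h (fockMeasure p m) :=
  hh.mono_ac (withDensity_absolutelyContinuous _ _)

theorem weightedNorm_indicator_le {p : ℝ≥0} {m : ℕ} (s : Set ℂ) (h : ℂ → ℂ) :
    weightedNorm p m (s.indicator h) ≤ weightedNorm p m h := by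
  refine eLpNorm_mono fun v => ?_
  by_cases hv : v ∈ s
  · simp [hv]
  · simpa [hv] using mul_nonneg (abs_nonneg _) (norm_nonneg _)

theorem weightedNorm_indicator_closedBall_mul_le {p : ℝ≥0} {m : ℕ} {a q : ℂ → ℂ} {R B : ℝ} (hR : 0 ≤ R)
    (hq : ∀ v, ‖v‖ ≤ R → ‖q v‖ ≤ B) :
    weightedNorm p m ((Metric.closedBall 0 R).indicator fun v => a v * q v)
      ≤ ENNReal.ofReal (R ^ m * B) * eLpNorm a p (volume.restrict (Metric.closedBall 0 R)) := by
  have hB : 0 ≤ B := (norm_nonneg _).trans (hq 0 (by simpa using hR))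
  rw [← eLpNorm_indicator_eq_eLpNorm_restrict Metric.isClosed_closedBall.measurableSet]
  refine eLpNorm_le_mul_eLpNorm_of_ae_le_mul (ae_of_all _ fun v => ?_) _
  by_cases hv : v ∈ Metric.closedBall (0 : ℂ) R
  · have hv' : ‖v‖ ≤ R := by simpa using hv
    simp only [indicator_of_mem hv]
    rw [norm_mul, norm_mul, Complex.norm_real, Real.norm_of_nonneg (fockWeight_nonneg _ _)]
    have h1 : fockWeight m v ≤ R ^ m := by
      rw [fockWeight]
      have : Real.exp (-‖v‖ ^ 2 / 2) ≤ 1 := by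
        rw [Real.exp_le_one_iff]; nlinarith [sq_nonneg ‖v‖]
      calc ‖v‖ ^ m * Real.exp (-‖v‖ ^ 2 / 2) ≤ R ^ m * 1 := by gcongr
        _ = _ := mul_one _
    calc fockWeight m v * (‖a v‖ * ‖q v‖) ≤ R ^ m * (‖a v‖ * B) := by
          have := hq v hv'
          have := fockWeight_nonneg m v
          gcongr
      _ = _ := by ring
  · simp [hv]

section representation

variable {p : ℝ≥0} [Fact (1 ≤ (p : ℝ≥0∞))] {m : ℕ}

/-- Away from the origin, a null set, the density is positive; so both measures have the same null
sets. -/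
theorem ae_fockMeasure : ae (fockMeasure p m) = ae volume := by
  refine le_antisymm (withDensity_absolutelyContinuous _ _).ae_le
    (withDensity_absolutelyContinuous' (Measurable.aemeasurable (by fun_prop)) ?_).ae_le
  filter_upwards [Measure.ae_ne volume (0 : ℂ)] with v hv
  have h1 := fockOmega_pos (p := p) (m := m)
  have h2 : 0 < ‖v‖ := norm_pos_iff.2 hv
  rw [ne_eq, ENNReal.ofReal_eq_zero, not_le]
  positivity

/-- The ratio between the norm of `L^{p,m}` and the weighted norm. -/
def normRatio (p : ℝ≥0) (m : ℕ) : ℝ≥0 := Real.toNNReal (fockOmega p m) ^ (1 / (p : ℝ))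

theorem eLpNorm_eq_normRatio_mul (h : ℂ → ℂ) :
    eLpNorm h p (fockMeasure p m) = normRatio p m * weightedNorm p m h := by
  have hp := one_le_toReal_of_fact p
  rw [eLpNorm_fockMeasure, normRatio, ENNReal.coe_rpow_of_nonneg _ (by positivity)]
  rfl

theorem normRatio_pos : 0 < normRatio p m :=
  NNReal.rpow_pos (Real.toNNReal_pos.2 fockOmega_pos)

theorem weightedLp_enorm_eq (h : WeightedLp p m) :
    ‖h‖ₑ = normRatio p m * weightedNorm p m h := by
  rw [Lp.enorm_def, eLpNorm_eq_normRatio_mul]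

theorem weightedNorm_coe_ne_top (h : WeightedLp p m) : weightedNorm p m h ≠ ∞ := by
  intro H
  have := weightedLp_enorm_eq h
  rw [H, ENNReal.mul_top (by exact_mod_cast normRatio_pos.ne')] at this
  exact enorm_ne_top this

theorem norm_le_of_weightedNorm_le {h : WeightedLp p m} {k : ℂ → ℂ} (hk : h =ᵐ[volume] k)
    {C : ℝ≥0} {x : ℝ} (hx : 0 ≤ x) (H : weightedNorm p m k ≤ C * ENNReal.ofReal x) :
    ‖h‖ ≤ (normRatio p m * C : ℝ≥0) * x := by
  have h1 : ‖h‖ₑ ≤ normRatio p m * (C * ENNReal.ofReal x) := by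
    rw [weightedLp_enorm_eq, weightedNorm_congr hk]
    gcongr
  have h2 := ENNReal.toReal_mono (by finiteness) h1
  rw [toReal_enorm] at h2
  refine h2.trans (le_of_eq ?_)
  simp [ENNReal.toReal_ofReal hx, mul_assoc]

theorem exists_weightedLp {h : ℂ → ℂ} (hm : AEStronglyMeasurable h volume)
    (hh : weightedNorm p m h ≠ ∞) : ∃ k : WeightedLp p m, k =ᵐ[volume] h := by
  have hL : MemLp h p (fockMeasure p m) := by
    refine ⟨aestronglyMeasurable_fockMeasure hm, ?_⟩
    rw [eLpNorm_eq_normRatio_mul]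
    exact ENNReal.mul_lt_top ENNReal.coe_lt_top hh.lt_top
  refine ⟨hL.toLp h, ?_⟩
  have := hL.coeFn_toLp
  rwa [EventuallyEq, ae_fockMeasure] at this

theorem weightedLp_ext {h k : WeightedLp p m} (H : h =ᵐ[volume] k) : h = k := by
  refine Lp.ext ?_
  rwa [EventuallyEq, ae_fockMeasure]

theorem coeFn_add_volume (h k : WeightedLp p m) :
    (h + k : WeightedLp p m) =ᵐ[volume] fun v => h v + k v := by
  have := Lp.coeFn_add h k
  rwa [EventuallyEq, ae_fockMeasure] at this

theorem coeFn_sub_volume (h k : WeightedLp p m) :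
    (h - k : WeightedLp p m) =ᵐ[volume] fun v => h v - k v := by
  have := Lp.coeFn_sub h k
  rwa [EventuallyEq, ae_fockMeasure] at this

theorem coeFn_smul_volume (c : ℂ) (h : WeightedLp p m) :
    (c • h : WeightedLp p m) =ᵐ[volume] fun v => c * h v := by
  have := Lp.coeFn_smul c h
  rwa [EventuallyEq, ae_fockMeasure] at this

/-- A family of functions that is linear almost everywhere and bounded in the weighted norm
represents a bounded linear operator. -/
theorem exists_continuousLinearMap {E : Type*} [NormedAddCommGroup E] [NormedSpace ℂ E]
    {T : E → ℂ → ℂ} (hm : ∀ x, AEStronglyMeasurable (T x) volume)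
    (hadd : ∀ x y, T (x + y) =ᵐ[volume] fun v => T x v + T y v)
    (hsmul : ∀ (c : ℂ) x, T (c • x) =ᵐ[volume] fun v => c * T x v) {C : ℝ≥0}
    (hC : ∀ x, weightedNorm p m (T x) ≤ C * ‖x‖ₑ) :
    ∃ H : E →L[ℂ] WeightedLp p m, ∀ x, H x =ᵐ[volume] T x := by
  choose k hk using fun x => exists_weightedLp (hm x)
    (ne_top_of_le_ne_top (ENNReal.mul_ne_top ENNReal.coe_ne_top enorm_ne_top) (hC x))
  let L : E →ₗ[ℂ] WeightedLp p m :=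
    { toFun := k
      map_add' := fun x y => weightedLp_ext <| by
        filter_upwards [hk x, hk y, hk (x + y), hadd x y, coeFn_add_volume (k x) (k y)]
          with v h1 h2 h3 h4 h5
        rw [h5, h3, h4, h1, h2]
      map_smul' := fun c x => weightedLp_ext <| by
        filter_upwards [hk x, hk (c • x), hsmul c x, coeFn_smul_volume c (k x)] with v h1 h2 h3 h4
        rw [RingHom.id_apply, h4, h2, h3, h1] }
  refine ⟨L.mkContinuous (normRatio p m * C : ℝ≥0) fun x => ?_, hk⟩
  exact norm_le_of_weightedNorm_le (hk x) (norm_nonneg x) (by rw [ofReal_norm]; exact hC x)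

/-- The family `T f`, `f ∈ F^{p,m}`, represents a compact operator into `L^{p,m}`. -/
def RepresentsCompact (p : ℝ≥0) [Fact (1 ≤ (p : ℝ≥0∞))] (m : ℕ)
    (T : FockSobolev p m → ℂ → ℂ) : Prop :=
  ∃ H : FockSobolev p m →L[ℂ] WeightedLp p m,
    (∀ f, H f =ᵐ[volume] T f) ∧ IsCompactOperator H

theorem RepresentsCompact.congr {T S : FockSobolev p m → ℂ → ℂ} (hT : RepresentsCompact p m T)
    (h : ∀ f, T f =ᵐ[volume] S f) : RepresentsCompact p m S := by
  obtain ⟨H, h1, h2⟩ := hT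
  exact ⟨H, fun f => (h1 f).trans (h f), h2⟩

theorem RepresentsCompact.add {T S : FockSobolev p m → ℂ → ℂ} (hT : RepresentsCompact p m T)
    (hS : RepresentsCompact p m S) : RepresentsCompact p m fun f v => T f v + S f v := by
  obtain ⟨H, h1, h2⟩ := hT
  obtain ⟨K, k1, k2⟩ := hS
  refine ⟨H + K, fun f => ?_, h2.add k2⟩
  filter_upwards [h1 f, k1 f, coeFn_add_volume (H f) (K f)] with v e1 e2 e3
  rw [add_apply, e3, e1, e2]

theorem RepresentsCompact.sub {T S : FockSobolev p m → ℂ → ℂ} (hT : RepresentsCompact p m T)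
    (hS : RepresentsCompact p m S) : RepresentsCompact p m fun f v => T f v - S f v := by
  obtain ⟨H, h1, h2⟩ := hT
  obtain ⟨K, k1, k2⟩ := hS
  refine ⟨H - K, fun f => ?_, h2.sub k2⟩
  filter_upwards [h1 f, k1 f, coeFn_sub_volume (H f) (K f)] with v e1 e2 e3
  rw [sub_apply, e3, e1, e2]

theorem representsCompact_zero : RepresentsCompact p m fun _ _ => 0 := by
  refine ⟨0, fun f => ?_, isCompactOperator_zero⟩
  have := Lp.coeFn_zero ℂ (p : ℝ≥0∞) (fockMeasure p m)
  rwa [EventuallyEq, ae_fockMeasure] at this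

theorem RepresentsCompact.sum {T : ℕ → FockSobolev p m → ℂ → ℂ}
    (hT : ∀ k, RepresentsCompact p m (T k)) (N : ℕ) :
    RepresentsCompact p m fun f v => ∑ k ∈ Finset.range N, T k f v := by
  induction N with
  | zero => simpa using representsCompact_zero
  | succ N ih =>
    simp only [Finset.sum_range_succ]
    exact ih.add (hT N)

theorem representsCompact_rank_one (c : FockSobolev p m →L[ℂ] ℂ) {h : ℂ → ℂ}
    (hm : AEStronglyMeasurable h volume) (hh : weightedNorm p m h ≠ ∞) :
    RepresentsCompact p m fun f v => c f * h v := by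
  obtain ⟨k, hk⟩ := exists_weightedLp hm hh
  refine ⟨c.smulRight k, fun f => ?_,
    (isCompactOperator_of_locallyCompactSpace_dom c).clm_comp
      (ContinuousLinearMap.toSpanSingleton ℂ k)⟩
  filter_upwards [hk, coeFn_smul_volume (c f) k] with v h1 h2
  rw [ContinuousLinearMap.smulRight_apply, h2, h1]

/-- Compactness passes to limits in the operator norm. -/
theorem representsCompact_of_approx {T : FockSobolev p m → ℂ → ℂ}
    (hm : ∀ f, AEStronglyMeasurable (T f) volume)
    (hadd : ∀ f g, T (f + g) =ᵐ[volume] fun v => T f v + T g v)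
    (hsmul : ∀ (c : ℂ) f, T (c • f) =ᵐ[volume] fun v => c * T f v)
    (happ : ∀ ε : ℝ≥0, 0 < ε → ∃ S, RepresentsCompact p m S ∧
      ∀ f, weightedNorm p m (fun v => T f v - S f v) ≤ ε * ‖f‖ₑ) :
    RepresentsCompact p m T := by
  -- The approximant for ε = 1 already makes T bounded, as a bounded operator plus a difference of
  -- norm controlled by `b₁`.
  obtain ⟨S₁, ⟨H₁, r₁, -⟩, b₁⟩ := happ 1 one_pos
  obtain ⟨D, hD⟩ := exists_continuousLinearMap (p := p) (m := m)
    (T := fun f v => T f v - S₁ f v)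
    (fun f => (hm f).sub (((Lp.stronglyMeasurable (H₁ f)).aestronglyMeasurable).congr (r₁ f)))
    (fun f g => by
      have h0 := coeFn_add_volume (H₁ f) (H₁ g)
      rw [← map_add] at h0
      filter_upwards [hadd f g, r₁ f, r₁ g, r₁ (f + g), h0] with v h1 h2 h3 h4 h5
      rw [h1, ← h2, ← h3, ← h4, h5]; ring)
    (fun c f => by
      have h0 := coeFn_smul_volume c (H₁ f)
      rw [← map_smul] at h0
      filter_upwards [hsmul c f, r₁ f, r₁ (c • f), h0] with v h1 h2 h3 h4
      rw [h1, ← h2, ← h3, h4]; ring) b₁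
  have hH (f : FockSobolev p m) : (H₁ + D) f =ᵐ[volume] T f := by
    filter_upwards [r₁ f, hD f, coeFn_add_volume (H₁ f) (D f)] with v h1 h2 h3
    rw [add_apply, h3, h1, h2]; ring
  refine ⟨H₁ + D, hH, ?_⟩
  refine isClosed_setOfPred_isCompactOperator.closure_subset_iff.2 (subset_refl _)
    (Metric.mem_closure_iff.2 fun ε hε => ?_)
  have hκ := normRatio_pos (p := p) (m := m)
  -- Dividing by `normRatio p m` converts the weighted norm into that of L^{p,m}; the half makes the
  -- final inequality strict.
  obtain ⟨S, ⟨K, rK, cK⟩, bK⟩ := happ (Real.toNNReal (ε / 2) / normRatio p m)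
    (div_pos (Real.toNNReal_pos.2 (by positivity)) hκ)
  refine ⟨K, cK, ?_⟩
  rw [dist_eq_norm]
  refine lt_of_le_of_lt (ContinuousLinearMap.opNorm_le_bound _ (by positivity) fun f => ?_)
    (half_lt_self hε)
  have h0 : (H₁ + D - K) f =ᵐ[volume] fun v => T f v - S f v := by
    filter_upwards [hH f, rK f, coeFn_sub_volume ((H₁ + D) f) (K f)] with v h1 h2 h3
    rw [sub_apply, h3, h1, h2]
  have h1 := norm_le_of_weightedNorm_le h0 (norm_nonneg f) (by rw [ofReal_norm]; exact bK f)
  rwa [mul_div_cancel₀ _ hκ.ne', Real.coe_toNNReal _ (by positivity)] at h1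

theorem fockIntegrable_coe (h : WeightedLp p m) : FockIntegrable m h :=
  fockIntegrable_of_weightedNorm_ne_top (Lp.stronglyMeasurable h).aestronglyMeasurable
    (weightedNorm_coe_ne_top h)

/-- Compact operators composed with the projection and the restriction to a measurable set. -/
theorem RepresentsCompact.indicator_fockProj {T : FockSobolev p m → ℂ → ℂ}
    (hT : RepresentsCompact p m T) {s : Set ℂ} (hs : MeasurableSet s) :
    RepresentsCompact p m fun f => s.indicator (fockProj m (T f)) := by
  obtain ⟨L, hL⟩ := exists_continuousLinearMap (p := p) (m := m) (E := WeightedLp p m)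
    (T := fun h => s.indicator (fockProj m h))
    (C := (kernelMeasure m univ).toNNReal * (normRatio p m)⁻¹)
    (fun h => (aestronglyMeasurable_fockProj
      (Lp.stronglyMeasurable h).aestronglyMeasurable).indicator hs)
    (fun h k => ae_of_all _ fun v => by
      rw [fockProj_congr (coeFn_add_volume h k)]
      by_cases hv : v ∈ s
      · simp only [indicator_of_mem hv]
        exact fockProj_add (fockIntegrable_coe h) (fockIntegrable_coe k) v
      · simp [hv])
    (fun c h => ae_of_all _ fun v => by
      rw [fockProj_congr (coeFn_smul_volume c h)]
      by_cases hv : v ∈ s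
      · simp only [indicator_of_mem hv]
        exact fockProj_const_mul c _ v
      · simp [hv])
    (fun h => by
      have hκ := normRatio_pos (p := p) (m := m)
      have hκ0 : (normRatio p m : ℝ≥0∞) ≠ 0 := by exact_mod_cast hκ.ne'
      refine (weightedNorm_indicator_le _ _).trans
        ((weightedNorm_fockProj_le (Lp.stronglyMeasurable h).measurable).trans (le_of_eq ?_))
      rw [weightedLp_enorm_eq, ENNReal.coe_mul, ENNReal.coe_toNNReal (measure_ne_top _ _),
        ENNReal.coe_inv hκ.ne', mul_assoc, ← mul_assoc (normRatio p m : ℝ≥0∞)⁻¹,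
        ENNReal.inv_mul_cancel hκ0 ENNReal.coe_ne_top, one_mul])
  obtain ⟨H, h1, h2⟩ := hT
  refine ⟨L ∘L H, fun f => (hL (H f)).trans ?_, h2.clm_comp L⟩
  rw [fockProj_congr (h1 f)]

/-- The Taylor coefficients at the origin, as bounded functionals. -/
theorem exists_taylorCoeff (k : ℕ) {R : ℝ} (hR : 0 < R) {C : ℝ≥0}
    (hC : ∀ (f : FockSobolev p m) (z : ℂ), ‖z‖ ≤ R → ‖f z‖ ≤ C * ‖f‖) :
    ∃ c : FockSobolev p m →L[ℂ] ℂ, (∀ f, c f = (k.factorial : ℂ)⁻¹ * iteratedDeriv k f 0) ∧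
      ∀ f, ‖c f‖ ≤ C * ‖f‖ / R ^ k := by
  have hb (f : FockSobolev p m) :
      ‖(k.factorial : ℂ)⁻¹ * iteratedDeriv k f 0‖ ≤ C * ‖f‖ / R ^ k := by
    have h1 := Complex.norm_iteratedDeriv_le_of_forall_mem_sphere_norm_le (c := 0) k hR
      f.differentiable.diffContOnCl fun z hz => hC f z (by simpa using (mem_sphere_zero_iff_norm.1 hz).le)
    have hk : (0 : ℝ) < k.factorial := by exact_mod_cast k.factorial_pos
    rw [norm_mul, norm_inv, Complex.norm_natCast, inv_mul_le_iff₀ hk, ← mul_div_assoc]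
    exact h1
  let L : FockSobolev p m →ₗ[ℂ] ℂ :=
    { toFun := fun f => (k.factorial : ℂ)⁻¹ * iteratedDeriv k f 0
      map_add' := fun f g => by
        have h : iteratedDeriv k (f + g : FockSobolev p m) 0
            = iteratedDeriv k f 0 + iteratedDeriv k g 0 :=
          iteratedDeriv_add f.differentiable.contDiff.contDiffAt
            g.differentiable.contDiff.contDiffAt
        rw [h, mul_add]
      map_smul' := fun a f => by
        have h : iteratedDeriv k (a • f : FockSobolev p m) 0 = a • iteratedDeriv k f 0 :=
          iteratedDeriv_const_smul f.differentiable.contDiff.contDiffAt a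
        rw [h, RingHom.id_apply, smul_eq_mul, smul_eq_mul]; ring }
  refine ⟨L.mkContinuous (C / R ^ k) fun f => ?_, fun f => rfl, hb⟩
  refine (hb f).trans (le_of_eq ?_)
  ring

/-- Multiplication by a locally `p`-integrable function, restricted to a disk, is compact. -/
theorem representsCompact_indicator_mul {a : ℂ → ℂ} (ham : AEStronglyMeasurable a volume)
    (ha : MemLpLoc p a) {R : ℝ} (hR : 0 < R) :
    RepresentsCompact p m fun f => (Metric.closedBall 0 R).indicator fun v => a v * f v := by
  have hms : MeasurableSet (Metric.closedBall (0 : ℂ) R) :=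
    Metric.isClosed_closedBall.measurableSet
  -- Bounds on the disk of radius 2R give, by Cauchy's estimates, Taylor terms of geometric ratio
  -- 1/2 on the disk of radius R.
  obtain ⟨C, hC⟩ := exists_norm_apply_le (p := p) m (2 * R)
  set A := eLpNorm a p (volume.restrict (Metric.closedBall 0 R)) with hA
  have hAt : A ≠ ∞ := (ha _ (isCompact_closedBall 0 R)).2.ne
  choose c hc hcb using fun k => exists_taylorCoeff k (by positivity : 0 < 2 * R) hC
  refine representsCompact_of_approx (fun f => ?_) (fun f g => ae_of_all _ fun v => ?_)
    (fun b f => ae_of_all _ fun v => ?_) fun ε hε => ?_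
  · exact (ham.mul f.differentiable.continuous.aestronglyMeasurable).indicator hms
  · have : (f + g) v = f v + g v := rfl
    simp only [indicator, this]
    split_ifs <;> ring
  · have : (b • f) v = b * f v := rfl
    simp only [indicator, this]
    split_ifs <;> ring
  · set M : ℝ := R ^ m * (2 * C) * A.toReal with hM
    have hM0 : 0 ≤ M := by positivity
    obtain ⟨N, hN⟩ := exists_pow_lt_of_lt_one (K := ℝ) (x := ε / (M + 1)) (y := 1 / 2)
      (by positivity) (by norm_num)
    -- The finite rank approximant multiplies a by the Taylor polynomial of f of degree below N.
    refine ⟨fun f v => ∑ k ∈ Finset.range N, c k f *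
      (Metric.closedBall 0 R).indicator (fun v => a v * v ^ k) v,
      RepresentsCompact.sum (fun k => representsCompact_rank_one (c k) ?_ ?_) N, fun f => ?_⟩
    · exact (ham.mul (continuous_pow k).aestronglyMeasurable).indicator hms
    · refine ne_top_of_le_ne_top ?_ (weightedNorm_indicator_closedBall_mul_le (B := R ^ k) hR.le
        fun v hv => ?_)
      · exact ENNReal.mul_ne_top ENNReal.ofReal_ne_top hAt
      · rw [norm_pow]; gcongr
    · have h1 : (fun v => (Metric.closedBall 0 R).indicator (fun v => a v * f v) v -
          ∑ k ∈ Finset.range N, c k f *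
            (Metric.closedBall 0 R).indicator (fun v => a v * v ^ k) v)
          = (Metric.closedBall 0 R).indicator fun v =>
            a v * (f v - ∑ k ∈ Finset.range N, c k f * v ^ k) := by
        funext v
        by_cases hv : v ∈ Metric.closedBall (0 : ℂ) R
        · simp only [indicator_of_mem hv, mul_sub, Finset.mul_sum]
          congr 1
          exact Finset.sum_congr rfl fun k _ => by ring
        · simp [hv]
      have h2 (v : ℂ) (hv : ‖v‖ ≤ R) : ‖f v - ∑ k ∈ Finset.range N, c k f * v ^ k‖
          ≤ 2 * C * ‖f‖ * (1 / 2) ^ N := by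
        have hs : HasSum (fun k => c k f * v ^ k) (f v) := by
          have := Complex.hasSum_taylorSeries_of_entire f.differentiable 0 v
          have h6 (k : ℕ) : c k f * v ^ k
              = (k.factorial : ℂ)⁻¹ • (v - 0) ^ k • iteratedDeriv k f 0 := by
            simp only [hc, smul_eq_mul, sub_zero]
            ring
          simpa only [h6] using this
        have := norm_sub_le_of_geometric_bound_of_hasSum (r := 1 / 2) (C := C * ‖f‖)
          (by norm_num) (fun k => ?_) hs N
        · rw [norm_sub_rev]
          refine this.trans (le_of_eq ?_)
          ring
        · rw [norm_mul, norm_pow]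
          calc ‖c k f‖ * ‖v‖ ^ k ≤ C * ‖f‖ / (2 * R) ^ k * R ^ k := by
                gcongr
                exact hcb k f
            _ = _ := by rw [mul_pow, div_pow, one_pow]; field_simp
      rw [h1]
      refine (weightedNorm_indicator_closedBall_mul_le hR.le h2).trans ?_
      rw [← hA, ← ENNReal.ofReal_toReal hAt, ← ofReal_norm, ← ENNReal.ofReal_coe_nnreal,
        ← ENNReal.ofReal_mul (by positivity), ← ENNReal.ofReal_mul (by positivity)]
      refine ENNReal.ofReal_le_ofReal ?_
      have h3 : M * (1 / 2) ^ N ≤ ε := by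
        calc M * (1 / 2) ^ N ≤ (M + 1) * (ε / (M + 1)) := by gcongr; linarith
          _ = ε := by field_simp
      calc _ = M * (1 / 2) ^ N * ‖f‖ := by rw [hM]; ring
        _ ≤ _ := by gcongr

end representation

/-! ### Symbols of vanishing oscillation -/

section oscillation

/-- Cut the segment from z to v into equal steps of length at most r and sum the oscillations. The
extra 1 in the number of steps keeps it positive when v = z. -/
theorem dist_le_of_local_oscillation {b : ℂ → ℂ} {r δ : ℝ} (hr : 0 < r) (z v : ℂ)
    (h : ∀ x y, ‖x - z‖ ≤ ‖v - z‖ → ‖y - z‖ ≤ ‖v - z‖ → ‖y - x‖ ≤ r → ‖b x - b y‖ ≤ δ) :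
    ‖b z - b v‖ ≤ δ * (‖v - z‖ / r + 1) := by
  have hδ : 0 ≤ δ := by simpa using (norm_nonneg _).trans (h z z (by simp) (by simp) (by simpa using hr.le))
  set n : ℕ := ⌊‖v - z‖ / r⌋₊ + 1 with hn
  have hn0 : (0 : ℝ) < n := by positivity
  have hn1 : ‖v - z‖ / r ≤ n := by
    rw [hn]; push_cast; exact (Nat.lt_floor_add_one _).le
  have hn2 : (n : ℝ) ≤ ‖v - z‖ / r + 1 := by
    rw [hn]; push_cast; gcongr; exact Nat.floor_le (by positivity)
  set x : ℕ → ℂ := fun i => z + ((i : ℝ) / n : ℝ) * (v - z) with hx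
  have hxz (i : ℕ) (hi : i ≤ n) : ‖x i - z‖ ≤ ‖v - z‖ := by
    have h1 : (i : ℝ) / n ≤ 1 := by
      rw [div_le_one hn0]; exact_mod_cast hi
    rw [hx]
    simp only [add_sub_cancel_left]
    rw [norm_mul, Complex.norm_real, Real.norm_of_nonneg (by positivity)]
    exact mul_le_of_le_one_left (norm_nonneg _) h1
  have hstep (i : ℕ) : ‖x (i + 1) - x i‖ ≤ r := by
    have : x (i + 1) - x i = ((1 / n : ℝ) : ℂ) * (v - z) := by
      simp only [hx]; push_cast; ring
    rw [this, norm_mul, Complex.norm_real, Real.norm_of_nonneg (by positivity), one_div,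
      inv_mul_le_iff₀ hn0]
    rwa [div_le_iff₀ hr] at hn1
  have h1 := dist_le_range_sum_of_dist_le (f := fun i => b (x i)) n (d := fun _ => δ) fun {i} hi => by
    rw [dist_eq_norm]
    exact h _ _ (hxz i hi.le) (hxz (i + 1) hi) (hstep i)
  have hx0 : x 0 = z := by simp [hx]
  have hxn : x n = v := by
    have : (n : ℂ) ≠ 0 := by exact_mod_cast hn0.ne'
    simp [hx, this]
  rw [hx0, hxn, dist_eq_norm, Finset.sum_const, Finset.card_range, nsmul_eq_mul, mul_comm] at h1
  exact h1.trans (by gcongr)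

variable {b : ℂ → ℂ} {r : ℝ}

/-- A step of length at most r either has both ends beyond ρ, where b oscillates by at most 1, or
stays in the disk of radius |ρ| + r, where b is bounded. The absolute value allows for a negative ρ.
-/
theorem exists_linear_growth (hr : 0 < r) (hloc : ∀ M : ℝ, ∃ B : ℝ, ∀ z, ‖z‖ ≤ M → ‖b z‖ ≤ B)
    (hosc : ∀ ε : ℝ, 0 < ε → ∃ ρ : ℝ, ∀ z u, ρ < ‖z‖ → ρ < ‖u‖ → ‖u - z‖ ≤ r → ‖b z - b u‖ ≤ ε) :
    ∃ C : ℝ, 0 ≤ C ∧ ∀ z v, ‖b z - b v‖ ≤ C * (1 + ‖z - v‖) := by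
  obtain ⟨ρ, hρ⟩ := hosc 1 one_pos
  obtain ⟨B, hB⟩ := hloc (|ρ| + r)
  have hB0 : 0 ≤ B := (norm_nonneg _).trans (hB 0 (by rw [norm_zero]; positivity))
  refine ⟨(1 + 2 * B) * (1 / r + 1), by positivity, fun z v => ?_⟩
  have h1 := dist_le_of_local_oscillation (δ := 1 + 2 * B) hr z v fun x y _ _ hxy => by
    have hρ' := le_abs_self ρ
    have ha := norm_le_norm_add_norm_sub' x y
    have hb := norm_le_norm_add_norm_sub' y x
    rw [norm_sub_rev] at ha
    by_cases hx : ρ < ‖x‖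
    · by_cases hy : ρ < ‖y‖
      · linarith [hρ x y hx hy hxy]
      · linarith [norm_sub_le (b x) (b y), hB x (by linarith), hB y (by linarith)]
    · linarith [norm_sub_le (b x) (b y), hB x (by linarith), hB y (by linarith)]
  refine h1.trans ?_
  rw [mul_assoc, norm_sub_rev v z]
  gcongr
  have : 0 < 1 / r := by positivity
  have := norm_nonneg (z - v)
  rw [div_eq_mul_one_div]
  nlinarith

/-- If |z - v| ≤ |z|/2, the segment stays far out, where each step costs little. Otherwise |z - v|
is itself large, and the linear bound C(1+t) is below ε(1+t)² because C/ε ≤ 1 + t; this is why the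
square appears. -/
theorem exists_radius_oscillation_le (hr : 0 < r)
    (hloc : ∀ M : ℝ, ∃ B : ℝ, ∀ z, ‖z‖ ≤ M → ‖b z‖ ≤ B)
    (hosc : ∀ ε : ℝ, 0 < ε → ∃ ρ : ℝ, ∀ z u, ρ < ‖z‖ → ρ < ‖u‖ → ‖u - z‖ ≤ r → ‖b z - b u‖ ≤ ε)
    {ε : ℝ} (hε : 0 < ε) :
    ∃ R : ℝ, ∀ z, R < ‖z‖ → ∀ v, ‖b z - b v‖ ≤ ε * (1 + ‖z - v‖) ^ 2 := by
  obtain ⟨C, hC0, hC⟩ := exists_linear_growth hr hloc hosc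
  have hr' : 0 < 1 / r := by positivity
  obtain ⟨ρ, hρ⟩ := hosc (ε / (1 / r + 1)) (by positivity)
  refine ⟨max (2 * ρ) (2 * (C / ε)), fun z hz v => ?_⟩
  have hz1 : 2 * ρ < ‖z‖ := (le_max_left _ _).trans_lt hz
  have hz2 : 2 * (C / ε) < ‖z‖ := (le_max_right _ _).trans_lt hz
  set t := ‖z - v‖ with ht
  have ht0 : 0 ≤ t := norm_nonneg _
  rcases le_total t (‖z‖ / 2) with h | h
  · have hx {x : ℂ} (hx : ‖x - z‖ ≤ ‖v - z‖) : ρ < ‖x‖ := by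
      have := norm_le_norm_add_norm_sub' z x
      rw [norm_sub_rev] at this
      rw [norm_sub_rev v z] at hx
      linarith
    refine (dist_le_of_local_oscillation hr z v fun x y h1 h2 h3 => hρ x y (hx h1) (hx h2) h3).trans ?_
    rw [norm_sub_rev, ← ht, div_mul_eq_mul_div, div_le_iff₀ (by positivity), div_eq_mul_one_div t,
      mul_assoc]
    gcongr
    nlinarith [mul_nonneg ht0 hr'.le, mul_nonneg (mul_nonneg ht0 ht0) hr'.le]
  · refine (hC z v).trans ?_
    rw [← ht]
    have h1 : C / ε ≤ 1 + t := by linarith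
    rw [div_le_iff₀ hε] at h1
    nlinarith

end oscillation

/-! ### Disk means of VMO functions -/

theorem MemLpLoc.sub {p : ℝ≥0} {g h : ℂ → ℂ} (hg : MemLpLoc p g) (hh : MemLpLoc p h) :
    MemLpLoc p fun v => g v - h v :=
  fun K hK => (hg K hK).sub (hh K hK)

theorem MemVMO.conj {p : ℝ≥0} {r : ℝ} {g : ℂ → ℂ} (hg : MemVMO p r g) : MemVMO p r fun v => conj (g v) := by
  have h1 (z : ℂ) : diskMean r (fun v => starRingEnd ℂ (g v)) z = starRingEnd ℂ (diskMean r g z) := by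
    rw [diskMean, diskMean, map_mul, Complex.conj_ofReal, integral_conj]
  refine ⟨fun K hK => (hg.1 K hK).star, ?_⟩
  simp_rw [h1, ← map_sub, RCLike.norm_conj]
  exact hg.2

section vmo

variable {p : ℝ≥0} [Fact (1 ≤ (p : ℝ≥0∞))] {r : ℝ} {g : ℂ → ℂ}

theorem MemLpLoc.locallyIntegrable (hg : MemLpLoc p g) : LocallyIntegrable g := by
  refine locallyIntegrable_iff.2 fun K hK => ?_
  have : IsFiniteMeasure (volume.restrict K) := ⟨by simpa using hK.measure_lt_top⟩
  exact (hg K hK).integrable Fact.out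

theorem MemLpLoc.aestronglyMeasurable (hg : MemLpLoc p g) : AEStronglyMeasurable g volume :=
  hg.locallyIntegrable.aestronglyMeasurable

theorem MemLpLoc.exists_norm_diskMean_le (hg : MemLpLoc p g) (r M : ℝ) :
    ∃ B : ℝ, ∀ z, ‖z‖ ≤ M → ‖diskMean r g z‖ ≤ B := by
  have hI : IntegrableOn g (Metric.closedBall 0 (M + r)) :=
    hg.locallyIntegrable.integrableOn_isCompact (isCompact_closedBall 0 (M + r))
  refine ⟨‖((1 / (Real.pi * r ^ 2) : ℝ) : ℂ)‖ * ∫ v in Metric.closedBall 0 (M + r), ‖g v‖,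
    fun z hz => ?_⟩
  rw [diskMean, norm_mul]
  gcongr
  refine (norm_integral_le_integral_norm _).trans ?_
  refine setIntegral_mono_set hI.norm (ae_of_all _ fun _ => norm_nonneg _) ?_
  refine LE.le.eventuallyLE (Metric.closedBall_subset_closedBall' ?_)
  rw [dist_zero_right]; linarith

theorem aestronglyMeasurable_diskMean (hg : AEStronglyMeasurable g volume) (r : ℝ) :
    AEStronglyMeasurable (diskMean r g) volume := by
  have h1 : diskMean r g = fun z => ((1 / (Real.pi * r ^ 2) : ℝ) : ℂ) *
      ∫ v, {q : ℂ × ℂ | dist q.2 q.1 ≤ r}.indicator (fun q => hg.mk g q.2) (z, v) := by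
    funext z
    rw [diskMean, setIntegral_congr_ae₀ (g := hg.mk g)
      Metric.isClosed_closedBall.measurableSet.nullMeasurableSet
      (hg.ae_eq_mk.mono fun v hv _ => hv),
      ← integral_indicator Metric.isClosed_closedBall.measurableSet]
    rfl
  rw [h1]
  refine (StronglyMeasurable.const_mul ?_ _).aestronglyMeasurable
  refine StronglyMeasurable.integral_prod_right (f := fun z v =>
    {q : ℂ × ℂ | dist q.2 q.1 ≤ r}.indicator (fun q => hg.mk g q.2) (z, v)) ?_
  refine StronglyMeasurable.indicator (hg.stronglyMeasurable_mk.comp_measurable measurable_snd) ?_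
  exact (isClosed_le (by fun_prop) continuous_const).measurableSet

theorem MemLpLoc.diskMean (hg : MemLpLoc p g) (r : ℝ) : MemLpLoc p (diskMean r g) := by
  intro K hK
  obtain ⟨M, hM⟩ := hK.isBounded.exists_norm_le
  obtain ⟨B, hB⟩ := hg.exists_norm_diskMean_le r M
  have : IsFiniteMeasure (volume.restrict K) := ⟨by simpa using hK.measure_lt_top⟩
  refine MemLp.of_bound (aestronglyMeasurable_diskMean hg.aestronglyMeasurable r).restrict B ?_
  exact ae_restrict_of_forall_mem hK.measurableSet fun z hz => hB z (hM z hz)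

/-- Strips the p-th root and the area normalization from the definition, so that later estimates are
plain monotonicity in `ℝ≥0∞`. -/
theorem MemVMO.exists_setLIntegral_le (hr : 0 < r) (hg : MemVMO p r g) {ε : ℝ≥0∞} (hε : ε ≠ 0) :
    ∃ ρ : ℝ, ∀ z, ρ < ‖z‖ →
      ∫⁻ v in Metric.closedBall z r, ‖g v - diskMean r g z‖ₑ ^ (p : ℝ) ≤ ε := by
  have hp := one_le_toReal_of_fact p
  have hc : 0 < 1 / (Real.pi * r ^ 2) := by have := Real.pi_pos; positivity
  set I : ℂ → ℝ := fun z => ∫ v in Metric.closedBall z r, ‖g v - diskMean r g z‖ ^ (p : ℝ) with hI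
  have hI0 (z : ℂ) : 0 ≤ I z := integral_nonneg fun v => by positivity
  have h1 : Tendsto I (cocompact ℂ) (𝓝 0) := by
    have h2 := (hg.2.rpow_const (p := (p : ℝ)) (Or.inr (by linarith))).const_mul
      (1 / (Real.pi * r ^ 2))⁻¹
    rw [Real.zero_rpow (by linarith), mul_zero] at h2
    refine h2.congr fun z => ?_
    rw [← Real.rpow_mul (mul_nonneg hc.le (hI0 z)), one_div_mul_cancel (by linarith), Real.rpow_one,
      inv_mul_cancel_left₀ hc.ne']
  have h2 (z : ℂ) : ∫⁻ v in Metric.closedBall z r, ‖g v - diskMean r g z‖ₑ ^ (p : ℝ)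
      = ENNReal.ofReal (I z) := by
    have hK : IsCompact (Metric.closedBall z r) := isCompact_closedBall z r
    have : IsFiniteMeasure (volume.restrict (Metric.closedBall z r)) :=
      ⟨by simpa using hK.measure_lt_top (μ := volume)⟩
    have hL : MemLp (fun v => g v - diskMean r g z) p (volume.restrict (Metric.closedBall z r)) :=
      (hg.1 _ hK).sub (memLp_const _)
    have hInt := hL.integrable_norm_rpow coe_ne_zero_of_fact ENNReal.coe_ne_top
    rw [ENNReal.coe_toReal] at hInt
    rw [hI, ofReal_integral_eq_lintegral_ofReal hInt (ae_of_all _ fun v => by positivity)]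
    refine lintegral_congr fun v => ?_
    rw [← ofReal_norm, ENNReal.ofReal_rpow_of_nonneg (norm_nonneg _) (by linarith)]
  have h3 : Tendsto (fun z => ENNReal.ofReal (I z)) (cocompact ℂ) (𝓝 0) := by
    simpa using ENNReal.tendsto_ofReal h1
  have h4 := h3.eventually (ge_mem_nhds (pos_iff_ne_zero.2 hε))
  rw [← Metric.cobounded_eq_cocompact, ← comap_norm_atTop, eventually_comap] at h4
  obtain ⟨ρ, hρ⟩ := eventually_atTop.1 h4
  exact ⟨ρ, fun z hz => by rw [h2]; exact hρ _ hz.le z rfl⟩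

theorem enorm_sub_rpow_le (x y w : ℂ) :
    ‖x - y‖ₑ ^ (p : ℝ) ≤ 2 ^ ((p : ℝ) - 1) * (‖w - x‖ₑ ^ (p : ℝ) + ‖w - y‖ₑ ^ (p : ℝ)) := by
  have hp := one_le_toReal_of_fact p
  refine le_trans ?_ (ENNReal.rpow_add_le_mul_rpow_add_rpow _ _ hp)
  gcongr
  rw [show x - y = (w - y) - (w - x) by ring, add_comm]
  exact enorm_sub_le

/-- The disk means of a function of vanishing mean oscillation have vanishing oscillation. -/
theorem MemVMO.exists_diskMean_oscillation_le (hr : 0 < r) (hg : MemVMO p r g) {ε : ℝ}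
    (hε : 0 < ε) : ∃ ρ : ℝ, ∀ z u, ρ < ‖z‖ → ρ < ‖u‖ → ‖u - z‖ ≤ r →
      ‖diskMean r g z - diskMean r g u‖ ≤ ε := by
  have hp := one_le_toReal_of_fact p
  have hgm := hg.1.aestronglyMeasurable
  set V : ℝ≥0∞ := volume (Metric.closedBall (0 : ℂ) (r / 2)) with hV
  have hV0 : V ≠ 0 := (Metric.measure_closedBall_pos _ _ (by positivity)).ne'
  have hVt : V ≠ ∞ := measure_closedBall_lt_top.ne
  set c : ℝ≥0∞ := 2 ^ ((p : ℝ) - 1) with hc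
  have hc0 : c ≠ 0 := by simp [hc, ENNReal.rpow_eq_zero_iff]
  have hct : c ≠ ∞ := ENNReal.rpow_ne_top_of_nonneg (by linarith) ENNReal.ofNat_ne_top
  have hεp : ENNReal.ofReal ε ^ (p : ℝ) ≠ 0 := by
    simp [ENNReal.rpow_eq_zero_iff, hε]
  -- The tolerance is chosen so that two such integrals, multiplied by the convexity constant c, add
  -- up to ε^p V.
  obtain ⟨ρ, hρ⟩ := hg.exists_setLIntegral_le hr
    (ε := c⁻¹ * (ENNReal.ofReal ε ^ (p : ℝ) * V) / 2)
    (by simp [hct, hεp, hV0])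
  refine ⟨ρ, fun z u hz hu hzu => ?_⟩
  -- The disk of radius r/2 about the midpoint lies in both B(z;r) and B(u;r), so g can be compared
  -- with both means on it.
  set x := (z + u) / 2 with hx
  have hxz : dist x z = ‖u - z‖ / 2 := by
    rw [dist_eq_norm, hx, show (z + u) / 2 - z = (u - z) / 2 by ring]; simp
  have hxu : dist x u = ‖u - z‖ / 2 := by
    rw [dist_eq_norm, hx, show (z + u) / 2 - u = -((u - z) / 2) by ring]; simp
  have hVx : volume (Metric.closedBall x (r / 2)) = V := by
    rw [hV, Measure.addHaar_closedBall_center]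
  have h1 : ‖diskMean r g z - diskMean r g u‖ₑ ^ (p : ℝ) * V ≤ ENNReal.ofReal ε ^ (p : ℝ) * V := by
    calc ‖diskMean r g z - diskMean r g u‖ₑ ^ (p : ℝ) * V
        = ∫⁻ v in Metric.closedBall x (r / 2), ‖diskMean r g z - diskMean r g u‖ₑ ^ (p : ℝ) := by
          rw [setLIntegral_const, hVx]
      _ ≤ ∫⁻ v in Metric.closedBall x (r / 2), c * (‖g v - diskMean r g z‖ₑ ^ (p : ℝ)
          + ‖g v - diskMean r g u‖ₑ ^ (p : ℝ)) :=
          lintegral_mono fun v => enorm_sub_rpow_le _ _ _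
      _ = c * ((∫⁻ v in Metric.closedBall x (r / 2), ‖g v - diskMean r g z‖ₑ ^ (p : ℝ))
          + ∫⁻ v in Metric.closedBall x (r / 2), ‖g v - diskMean r g u‖ₑ ^ (p : ℝ)) := by
          rw [lintegral_const_mul' _ _ hct, lintegral_add_left']
          exact ((hgm.restrict.sub aestronglyMeasurable_const).enorm).pow_const _
      _ ≤ c * ((∫⁻ v in Metric.closedBall z r, ‖g v - diskMean r g z‖ₑ ^ (p : ℝ))
          + ∫⁻ v in Metric.closedBall u r, ‖g v - diskMean r g u‖ₑ ^ (p : ℝ)) := by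
          gcongr
          · exact Metric.closedBall_subset_closedBall' (by linarith)
          · exact Metric.closedBall_subset_closedBall' (by linarith)
      _ ≤ c * (c⁻¹ * (ENNReal.ofReal ε ^ (p : ℝ) * V) / 2
          + c⁻¹ * (ENNReal.ofReal ε ^ (p : ℝ) * V) / 2) := by
          gcongr
          · exact hρ z hz
          · exact hρ u hu
      _ = _ := by
          rw [ENNReal.add_halves, ← mul_assoc, ENNReal.mul_inv_cancel hc0 hct, one_mul]
  rw [ENNReal.mul_le_mul_iff_left hV0 hVt, ENNReal.rpow_le_rpow_iff (by linarith), ← ofReal_norm,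
    ENNReal.ofReal_le_ofReal_iff hε.le] at h1
  exact h1

/-- The remainder `g - g̃_r` of a function of vanishing mean oscillation has vanishing local
`L^p` norms. -/
theorem MemVMO.exists_setLIntegral_remainder_le (hr : 0 < r) (hg : MemVMO p r g) {δ : ℝ≥0∞}
    (hδ : δ ≠ 0) : ∃ ρ : ℝ, ∀ u, ρ < ‖u‖ →
      ∫⁻ v in Metric.closedBall u r, ‖g v - diskMean r g v‖ₑ ^ (p : ℝ) ≤ δ := by
  have hp := one_le_toReal_of_fact p
  have hgm := hg.1.aestronglyMeasurable
  set V : ℝ≥0∞ := volume (Metric.closedBall (0 : ℂ) r) with hV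
  have hVt : V ≠ ∞ := measure_closedBall_lt_top.ne
  set c : ℝ≥0∞ := 2 ^ ((p : ℝ) - 1) with hc
  have hc0 : c ≠ 0 := by simp [hc, ENNReal.rpow_eq_zero_iff]
  have hct : c ≠ ∞ := ENNReal.rpow_ne_top_of_nonneg (by linarith) ENNReal.ofNat_ne_top
  have hη0 : c⁻¹ * δ / 2 ≠ 0 := by simp [hct, hδ]
  obtain ⟨ρ₁, hρ₁⟩ := hg.exists_setLIntegral_le hr hη0
  obtain ⟨ε, hε, hεV⟩ : ∃ ε : ℝ, 0 < ε ∧ ENNReal.ofReal ε ^ (p : ℝ) * V ≤ c⁻¹ * δ / 2 := by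
    have ht : Tendsto (fun ε : ℝ => ENNReal.ofReal ε ^ (p : ℝ) * V) (𝓝[>] 0) (𝓝 0) := by
      have h1 : Tendsto (fun ε : ℝ => ENNReal.ofReal ε ^ (p : ℝ)) (𝓝[>] 0) (𝓝 0) := by
        have h2 : Continuous fun ε : ℝ => ENNReal.ofReal ε ^ (p : ℝ) :=
          ENNReal.continuous_rpow_const.comp ENNReal.continuous_ofReal
        have h3 := (h2.tendsto 0).mono_left (nhdsWithin_le_nhds (s := Ioi 0))
        rwa [ENNReal.ofReal_zero, ENNReal.zero_rpow_of_pos (by linarith)] at h3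
      simpa using ENNReal.Tendsto.mul_const h1 (Or.inr hVt)
    obtain ⟨ε, h1, h2⟩ := ((ht.eventually (ge_mem_nhds (pos_iff_ne_zero.2 hη0))).and
      self_mem_nhdsWithin).exists
    exact ⟨ε, h2, h1⟩
  obtain ⟨ρ₂, hρ₂⟩ := hg.exists_diskMean_oscillation_le hr hε
  -- The added r ensures that every point of B(u;r) lies beyond ρ₂.
  refine ⟨max ρ₁ (ρ₂ + r), fun u hu => ?_⟩
  have hu1 : ρ₁ < ‖u‖ := (le_max_left _ _).trans_lt hu
  have hu2 : ρ₂ + r < ‖u‖ := (le_max_right _ _).trans_lt hu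
  calc ∫⁻ v in Metric.closedBall u r, ‖g v - diskMean r g v‖ₑ ^ (p : ℝ)
      ≤ ∫⁻ v in Metric.closedBall u r, c * (‖g v - diskMean r g u‖ₑ ^ (p : ℝ)
          + ENNReal.ofReal ε ^ (p : ℝ)) := by
        refine setLIntegral_mono' Metric.isClosed_closedBall.measurableSet fun v hv => ?_
        refine (enorm_sub_rpow_le (g v) (diskMean r g v) (diskMean r g u)).trans ?_
        have hv' : ‖v - u‖ ≤ r := by rwa [Metric.mem_closedBall, dist_eq_norm] at hv
        have hvn : ρ₂ < ‖v‖ := by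
          have := norm_le_norm_add_norm_sub' u v
          rw [norm_sub_rev] at this
          linarith
        have h2 := hρ₂ u v (by linarith) hvn hv'
        rw [enorm_sub_rev]
        gcongr
        rw [← ofReal_norm]
        exact ENNReal.ofReal_le_ofReal h2
    _ = c * ((∫⁻ v in Metric.closedBall u r, ‖g v - diskMean r g u‖ₑ ^ (p : ℝ))
          + ENNReal.ofReal ε ^ (p : ℝ) * V) := by
        rw [lintegral_const_mul' _ _ hct, lintegral_add_right _ measurable_const,
          setLIntegral_const, hV, Measure.addHaar_closedBall_center volume u]
    _ ≤ c * (c⁻¹ * δ / 2 + c⁻¹ * δ / 2) := by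
        gcongr
        exact hρ₁ u hu1
    _ = δ := by
        rw [ENNReal.add_halves, ← mul_assoc, ENNReal.mul_inv_cancel hc0 hct, one_mul]

end vmo

/-! ### Compactness of the Hankel operators -/

section hankel

variable {p : ℝ≥0} [Fact (1 ≤ (p : ℝ≥0∞))] {m : ℕ}

theorem FockIntegrable.const_mul {m : ℕ} {h : ℂ → ℂ} (hh : FockIntegrable m h) (c : ℂ) :
    FockIntegrable m fun v => c * h v := by
  refine ⟨hh.1.const_mul c, (hh.2.const_mul ‖c‖).congr (ae_of_all _ fun v => ?_)⟩
  simp only [norm_mul]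
  ring

theorem fockProj_sub {m : ℕ} {h k : ℂ → ℂ} (hh : FockIntegrable m h) (hk : FockIntegrable m k)
    (z : ℂ) : fockProj m (fun v => h v - k v) z = fockProj m h z - fockProj m k z := by
  have := fockProj_add hh (hk.const_mul (-1)) z
  rw [fockProj_const_mul] at this
  simpa [sub_eq_add_neg] using this

theorem FockSobolev.fockIntegrable (f : FockSobolev p m) : FockIntegrable m f :=
  fockIntegrable_of_weightedNorm_ne_top f.differentiable.continuous.aestronglyMeasurable
    (weightedNorm_ne_top f)

/-- Tonelli and the symmetry of |u - v| ≤ r: each Φ(u) is weighted by the mass of A on B(u;r). This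
is the Carleson-type step for `representsCompact_mul`. -/
theorem lintegral_mul_setLIntegral_closedBall_le {A Φ : ℂ → ℝ≥0∞} {r : ℝ} {δ : ℝ≥0∞}
    (hA : AEMeasurable A) (hΦ : Measurable Φ)
    (h : ∀ u, ∫⁻ v in Metric.closedBall u r, A v ≤ δ) :
    ∫⁻ v, A v * ∫⁻ u in Metric.closedBall v r, Φ u ≤ δ * ∫⁻ u, Φ u := by
  have hS : MeasurableSet {q : ℂ × ℂ | dist q.2 q.1 ≤ r} :=
    (isClosed_le (by fun_prop) continuous_const).measurableSet
  have hm : Measurable fun q : ℂ × ℂ =>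
      {q : ℂ × ℂ | dist q.2 q.1 ≤ r}.indicator (fun q => Φ q.2) q :=
    (hΦ.comp measurable_snd).indicator hS
  have hi (v : ℂ) : ∫⁻ u in Metric.closedBall v r, Φ u
      = ∫⁻ u, {q : ℂ × ℂ | dist q.2 q.1 ≤ r}.indicator (fun q => Φ q.2) (v, u) := by
    rw [← lintegral_indicator Metric.isClosed_closedBall.measurableSet]
    rfl
  have hmv (v : ℂ) : Measurable fun u =>
      {q : ℂ × ℂ | dist q.2 q.1 ≤ r}.indicator (fun q => Φ q.2) (v, u) :=
    hm.comp measurable_prodMk_left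
  calc ∫⁻ v, A v * ∫⁻ u in Metric.closedBall v r, Φ u
      = ∫⁻ v, ∫⁻ u, A v * {q : ℂ × ℂ | dist q.2 q.1 ≤ r}.indicator (fun q => Φ q.2) (v, u) := by
        refine lintegral_congr fun v => ?_
        rw [hi, lintegral_const_mul _ (hmv v)]
    _ = ∫⁻ u, ∫⁻ v, A v * {q : ℂ × ℂ | dist q.2 q.1 ≤ r}.indicator (fun q => Φ q.2) (v, u) :=
        lintegral_lintegral_swap (hA.comp_fst.mul hm.aemeasurable)
    _ = ∫⁻ u, (∫⁻ v in Metric.closedBall u r, A v) * Φ u := by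
        refine lintegral_congr fun u => ?_
        rw [← lintegral_indicator Metric.isClosed_closedBall.measurableSet,
          ← lintegral_mul_const'' _ (hA.indicator Metric.isClosed_closedBall.measurableSet)]
        refine lintegral_congr fun v => ?_
        by_cases hv : dist v u ≤ r
        · simp [indicator, hv, dist_comm u v]
        · simp [indicator, hv, dist_comm u v]
    _ ≤ ∫⁻ u, δ * Φ u := by gcongr with u; exact h u
    _ = _ := lintegral_const_mul _ hΦ

/-- Multiplication by a function whose local `L^p` norms vanish at infinity is compact. -/
theorem representsCompact_mul {a : ℂ → ℂ} (ha : MemLpLoc p a) {r : ℝ} (hr : 0 < r)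
    (hav : ∀ δ : ℝ≥0∞, δ ≠ 0 → ∃ ρ : ℝ, ∀ u, ρ < ‖u‖ →
      ∫⁻ v in Metric.closedBall u r, ‖a v‖ₑ ^ (p : ℝ) ≤ δ) :
    RepresentsCompact p m fun f v => a v * f v := by
  have hp := one_le_toReal_of_fact p
  have ham := ha.aestronglyMeasurable
  obtain ⟨C, hC⟩ := exists_weightedAbs_rpow_le_setLIntegral (p := p) hr
  obtain ⟨D, hD⟩ := exists_weightedNorm_le_enorm (p := p) m
  refine representsCompact_of_approx
    (fun f => ham.mul f.differentiable.continuous.aestronglyMeasurable)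
    (fun f g => ae_of_all _ fun v => ?_) (fun b f => ae_of_all _ fun v => ?_) fun ε hε => ?_
  · exact mul_add _ _ _
  · exact mul_left_comm _ _ _
  -- Chosen so that ηD ≤ ε and Cδ ≤ η^p; the added 1's avoid division by zero.
  set η : ℝ≥0 := ε / (D + 1) with hη
  have hη0 : 0 < η := by positivity
  set δ : ℝ≥0 := η ^ (p : ℝ) / (C + 1) with hδ
  have hδ0 : 0 < δ := div_pos (NNReal.rpow_pos hη0) (by positivity)
  obtain ⟨ρ, hρ⟩ := hav δ (by exact_mod_cast hδ0.ne')
  set R : ℝ := max (ρ + r) 1 with hR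
  have hms : MeasurableSet (Metric.closedBall (0 : ℂ) R) :=
    Metric.isClosed_closedBall.measurableSet
  refine ⟨_, representsCompact_indicator_mul ham ha (lt_max_of_lt_right one_pos : 0 < R),
    fun f => ?_⟩
  -- Since q is entire with the same weighted modulus as f, the sub-mean value inequality for weight
  -- index 0 applies to it.
  set q : ℂ → ℂ := fun v => v ^ m * f v with hq
  have hqd : Differentiable ℂ q := (differentiable_id.pow m).mul f.differentiable
  have hqw (v : ℂ) : weightedAbs 0 q v = weightedAbs m f v := by
    rw [hq, weightedAbs_pow_mul, zero_add]
  set A : ℂ → ℝ≥0∞ := (Metric.closedBall (0 : ℂ) R)ᶜ.indicator fun v => ‖a v‖ₑ ^ (p : ℝ) with hA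
  have hAm : AEMeasurable A := (ham.enorm.pow_const _).indicator hms.compl
  -- If |u| ≤ ρ, then B(u;r) lies in the removed disk because R ≥ ρ + r, and A vanishes on it.
  have hAδ (u : ℂ) : ∫⁻ v in Metric.closedBall u r, A v ≤ δ := by
    by_cases hu : ρ < ‖u‖
    · refine (lintegral_mono fun v => ?_).trans (hρ u hu)
      exact indicator_le_self _ _ _
    · rw [setLIntegral_congr_fun (g := fun _ => 0) Metric.isClosed_closedBall.measurableSet]
      · simp
      · intro v hv
        have hv' : ‖v - u‖ ≤ r := by rwa [Metric.mem_closedBall, dist_eq_norm] at hv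
        have : ‖v‖ ≤ R := by
          have := norm_le_norm_add_norm_sub' v u
          have := le_max_left (ρ + r) 1
          linarith
        simp [hA, this]
  have hle : weightedNorm p m (fun v => a v * f v -
      (Metric.closedBall 0 R).indicator (fun v => a v * f v) v) ≤ η * weightedNorm p m f := by
    refine weightedNorm_le_of_lintegral_le ?_
    calc _ ≤ ∫⁻ v, A v * (C * ∫⁻ u in Metric.closedBall v r, weightedAbs 0 q u ^ (p : ℝ)) := by
          refine lintegral_mono fun v => ?_
          dsimp only
          by_cases hv : v ∈ Metric.closedBall (0 : ℂ) R
          · simp [weightedAbs, hv, ENNReal.zero_rpow_of_pos (by linarith : (0 : ℝ) < p)]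
          · refine le_trans (le_of_eq ?_) (mul_le_mul_right (hC q hqd v) (A v))
            rw [hA, indicator_of_mem (by exact hv), hqw, ← ENNReal.mul_rpow_of_nonneg _ _ (by linarith)]
            congr 1
            rw [weightedAbs, weightedAbs, indicator_of_notMem hv, sub_zero, enorm_mul, enorm_mul,
              enorm_mul]
            ring
      _ = C * ∫⁻ v, A v * ∫⁻ u in Metric.closedBall v r, weightedAbs 0 q u ^ (p : ℝ) := by
          rw [← lintegral_const_mul' _ _ ENNReal.coe_ne_top]
          exact lintegral_congr fun v => by ring
      _ ≤ C * (δ * ∫⁻ u, weightedAbs 0 q u ^ (p : ℝ)) :=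
          mul_le_mul_right (lintegral_mul_setLIntegral_closedBall_le hAm
            ((continuous_weightedAbs 0 hqd.continuous).measurable.pow_const _) hAδ) _
      _ ≤ _ := by
          simp_rw [hqw]
          rw [← mul_assoc, ← ENNReal.coe_rpow_of_nonneg _ (by linarith : (0 : ℝ) ≤ p),
            ← ENNReal.coe_mul]
          gcongr
          rw [hδ]
          calc C * (η ^ (p : ℝ) / (C + 1)) ≤ (C + 1) * (η ^ (p : ℝ) / (C + 1)) := by
                gcongr; exact le_self_add
            _ = _ := mul_div_cancel₀ _ (by positivity)
  refine hle.trans ?_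
  calc (η : ℝ≥0∞) * weightedNorm p m f ≤ η * (D * ‖f‖ₑ) := by gcongr; exact hD f
    _ = ((η * D : ℝ≥0) : ℝ≥0∞) * ‖f‖ₑ := by rw [ENNReal.coe_mul, mul_assoc]
    _ ≤ _ := by
        gcongr
        rw [hη]
        calc ε / (D + 1) * D ≤ ε / (D + 1) * (D + 1) := by gcongr; exact le_self_add
          _ = ε := div_mul_cancel₀ _ (by positivity)

theorem RepresentsCompact.weightedNorm_ne_top {T : FockSobolev p m → ℂ → ℂ}
    (hT : RepresentsCompact p m T) (f : FockSobolev p m) : weightedNorm p m (T f) ≠ ∞ := by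
  obtain ⟨H, h1, -⟩ := hT
  rw [← weightedNorm_congr (h1 f)]
  exact weightedNorm_coe_ne_top (H f)

/-- M_a - P^m M_a is compact because P^m is bounded on L^{p,m}. -/
theorem RepresentsCompact.hankelFun {a : ℂ → ℂ}
    (ha : RepresentsCompact p m fun f v => a v * f v) :
    RepresentsCompact p m fun f => hankelFun m a f := by
  have := ha.sub (ha.indicator_fockProj MeasurableSet.univ)
  simp only [indicator_univ] at this
  exact this

/-- The Hankel operator of a symbol of vanishing oscillation is compact. -/
theorem representsCompact_hankelFun_of_oscillation {b : ℂ → ℂ} (hb : MemLpLoc p b) {r : ℝ}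
    (hr : 0 < r) (hloc : ∀ M : ℝ, ∃ B : ℝ, ∀ z, ‖z‖ ≤ M → ‖b z‖ ≤ B)
    (hosc : ∀ ε : ℝ, 0 < ε → ∃ ρ : ℝ, ∀ z u, ρ < ‖z‖ → ρ < ‖u‖ → ‖u - z‖ ≤ r → ‖b z - b u‖ ≤ ε) :
    (∀ f : FockSobolev p m, FockIntegrable m fun v => b v * f v) ∧
      RepresentsCompact p m fun f => hankelFun m b f := by
  have hbm := hb.aestronglyMeasurable
  obtain ⟨C, hC0, hC⟩ := exists_linear_growth hr hloc hosc
  obtain ⟨D, hD⟩ := exists_weightedNorm_le_enorm (p := p) m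
  set B : ℝ := ‖b 0‖ + C with hB
  have hB0 : 0 ≤ B := by positivity
  have hbB (v : ℂ) : ‖b v‖ ≤ B * (1 + ‖v‖) := by
    have h1 := hC 0 v
    have h2 := norm_le_norm_add_norm_sub' (b v) (b 0)
    rw [norm_sub_rev] at h2
    rw [zero_sub, norm_neg] at h1
    have h3 := mul_nonneg (norm_nonneg (b 0)) (norm_nonneg v)
    rw [hB]; nlinarith
  have hint (f : FockSobolev p m) : FockIntegrable m fun v => b v * f v :=
    fockIntegrable_mul hbm hbB f.differentiable.continuous.aestronglyMeasurable
      (weightedNorm_ne_top f)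
  refine ⟨hint, ?_⟩
  have hadd (f g : FockSobolev p m) : (fun v => b v * (f + g) v) = fun v => b v * f v + b v * g v := by
    funext v; exact mul_add _ _ _
  have hsmul (c : ℂ) (f : FockSobolev p m) : (fun v => b v * (c • f) v) = fun v => c * (b v * f v) := by
    funext v; exact mul_left_comm _ _ _
  refine representsCompact_of_approx (fun f => (hint f).1.sub (aestronglyMeasurable_fockProj (hint f).1))
    (fun f g => ae_of_all _ fun v => ?_) (fun c f => ae_of_all _ fun v => ?_) fun ε hε => ?_
  · have h1 := congrFun (hadd f g) v
    simp only [_root_.hankelFun]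
    rw [hadd, h1, fockProj_add (hint f) (hint g)]
    ring
  · have h1 := congrFun (hsmul c f) v
    simp only [_root_.hankelFun]
    rw [hsmul, h1, fockProj_const_mul]
    ring
  set K : ℝ≥0 := (kernelMeasure m univ).toNNReal with hK
  set η : ℝ≥0 := ε / (K * D + 1) with hη
  have hη0 : 0 < η := by positivity
  obtain ⟨R₀, hR₀⟩ := exists_radius_oscillation_le hr hloc hosc (ε := η) hη0
  -- R₀ handles |z| > R, and 2B/η handles |z| ≤ R < 2R < |v|, where |z - v| ≥ R.
  set R : ℝ := max (max R₀ (2 * B / η)) 1 with hR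
  have hRpos : 0 < R := lt_max_of_lt_right one_pos
  have hR1 : R₀ ≤ R := (le_max_left _ _).trans (le_max_left _ _)
  have hR2 : 2 * B / η ≤ R := (le_max_right _ _).trans (le_max_left _ _)
  have hms (s : ℝ) : MeasurableSet (Metric.closedBall (0 : ℂ) s) :=
    Metric.isClosed_closedBall.measurableSet
  -- The compact approximant lives on |z| ≤ R and sees b only on the disk of radius 2R; the gap
  -- between the radii makes the error small.
  refine ⟨_, (representsCompact_indicator_mul hbm hb hRpos).sub
    ((representsCompact_indicator_mul hbm hb (by positivity : 0 < 2 * R)).indicator_fockProj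
      (hms R)), fun f => ?_⟩
  set S : ℂ → ℂ := fun v => _root_.hankelFun m b f v -
    ((Metric.closedBall 0 R).indicator (fun v => b v * f v) v -
      (Metric.closedBall 0 R).indicator
        (fockProj m ((Metric.closedBall 0 (2 * R)).indicator fun v => b v * f v)) v) with hS
  have hcut : FockIntegrable m ((Metric.closedBall 0 (2 * R)).indicator fun v => b v * f v) := by
    have h1 : ((Metric.closedBall 0 (2 * R)).indicator fun v => b v * f v)
        = fun v => (Metric.closedBall 0 (2 * R)).indicator b v * f v := by
      funext v
      by_cases hv : v ∈ Metric.closedBall (0 : ℂ) (2 * R) <;> simp [hv]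
    rw [h1]
    refine fockIntegrable_mul (C := B) (hbm.indicator (hms _)) (fun v => ?_)
      f.differentiable.continuous.aestronglyMeasurable (_root_.weightedNorm_ne_top f)
    exact (norm_indicator_le_norm_self _ _).trans (hbB v)
  -- At every z the error is a projection of u f evaluated at z, with u depending on z: minus b
  -- outside the larger disk when |z| ≤ R, and b(z) - b otherwise.
  have hker (z : ℂ) : ∃ u : ℂ → ℂ, (∀ v, ‖u v‖ ≤ η * (1 + ‖z - v‖) ^ 2) ∧
      S z = fockProj m (fun v => u v * f v) z := by
    by_cases hz : z ∈ Metric.closedBall (0 : ℂ) R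
    · have hz' : ‖z‖ ≤ R := by simpa using hz
      refine ⟨fun v => (Metric.closedBall 0 (2 * R)).indicator b v - b v, fun v => ?_, ?_⟩
      · by_cases hv : v ∈ Metric.closedBall (0 : ℂ) (2 * R)
        · simp only [indicator_of_mem hv, sub_self, norm_zero]
          positivity
        · have hv' : 2 * R < ‖v‖ := by simpa using hv
          simp only [indicator_of_notMem hv, zero_sub, norm_neg]
          have h1 := norm_le_norm_add_norm_sub' v z
          rw [norm_sub_rev] at h1
          set t := ‖z - v‖
          have h2 : R ≤ t := by linarith
          have h3 : 2 * B ≤ η * (1 + t) := by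
            have : 2 * B / η ≤ 1 + t := by linarith
            rw [div_le_iff₀ (by exact_mod_cast hη0)] at this
            linarith
          calc ‖b v‖ ≤ B * (1 + ‖v‖) := hbB v
            _ ≤ B * (2 * (1 + t)) := by gcongr; linarith
            _ = 2 * B * (1 + t) := by ring
            _ ≤ η * (1 + t) * (1 + t) := by gcongr
            _ = _ := by ring
      · have h1 : (fun v => ((Metric.closedBall 0 (2 * R)).indicator b v - b v) * f v)
            = fun v => (Metric.closedBall 0 (2 * R)).indicator (fun v => b v * f v) v
              - b v * f v := by
          funext v
          by_cases hv : v ∈ Metric.closedBall (0 : ℂ) (2 * R) <;> simp [hv]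
        rw [h1, fockProj_sub hcut (hint f)]
        simp only [hS, indicator_of_mem hz, _root_.hankelFun]
        ring
    · have hz' : R < ‖z‖ := by simpa using hz
      refine ⟨fun v => b z - b v, hR₀ z (hR1.trans_lt hz'), ?_⟩
      have h1 : (fun v => (b z - b v) * f v) = fun v => b z * f v - b v * f v := by
        funext v; ring
      -- The reproducing identity turns b(z) P^m f(z) into b(z) f(z), the first term of the Hankel
      -- operator.
      rw [h1, fockProj_sub (f.fockIntegrable.const_mul _) (hint f), fockProj_const_mul,
        fockProj_eq_self f.differentiable f.fockIntegrable]
      simp only [hS, indicator_of_notMem hz, _root_.hankelFun]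
      ring
  have hle : weightedNorm p m S ≤ ENNReal.ofReal η * kernelMeasure m univ * weightedNorm p m f := by
    refine weightedNorm_le_of_le_lintegral_kernelMeasure f.differentiable.continuous.measurable
      fun z => ?_
    obtain ⟨u, hu, hSu⟩ := hker z
    rw [weightedAbs, hSu]
    exact enorm_fockWeight_mul_fockProj_le hu
  refine hle.trans ?_
  rw [ENNReal.ofReal_coe_nnreal, ← ENNReal.coe_toNNReal (measure_ne_top (kernelMeasure m) univ),
    ← hK]
  calc (η : ℝ≥0∞) * K * weightedNorm p m f ≤ η * K * (D * ‖f‖ₑ) := by gcongr; exact hD f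
    _ = ((η * (K * D) : ℝ≥0) : ℝ≥0∞) * ‖f‖ₑ := by push_cast; ring
    _ ≤ _ := by
        gcongr
        rw [hη]
        calc ε / (K * D + 1) * (K * D) ≤ ε / (K * D + 1) * (K * D + 1) := by
              gcongr; exact le_self_add
          _ = ε := div_mul_cancel₀ _ (by positivity)

theorem isCompactHankel_of_memVMO {r : ℝ} (hr : 0 < r) {g : ℂ → ℂ} (hg : MemVMO p r g) :
    IsCompactHankel p m g := by
  set b := diskMean r g with hb
  set a : ℂ → ℂ := fun v => g v - b v with ha
  have hgm := hg.1.aestronglyMeasurable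
  have hbl : MemLpLoc p b := hg.1.diskMean r
  have hal : MemLpLoc p a := hg.1.sub hbl
  have hMa : RepresentsCompact p m fun f v => a v * f v :=
    representsCompact_mul hal hr fun δ hδ => hg.exists_setLIntegral_remainder_le hr hδ
  obtain ⟨hbi, hHb⟩ := representsCompact_hankelFun_of_oscillation (m := m) hbl hr
    (hg.1.exists_norm_diskMean_le r) fun ε hε => hg.exists_diskMean_oscillation_le hr hε
  have hai (f : FockSobolev p m) : FockIntegrable m fun v => a v * f v :=
    fockIntegrable_of_weightedNorm_ne_top
      (hal.aestronglyMeasurable.mul f.differentiable.continuous.aestronglyMeasurable)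
      (hMa.weightedNorm_ne_top f)
  have hsplit (f : FockSobolev p m) : (fun v => g v * f v) = fun v => a v * f v + b v * f v := by
    funext v; simp only [ha]; ring
  refine ⟨fun f z => ?_, ?_⟩
  · rw [hsplit]
    exact ((hai f).add (hbi f)).integrable_projIntegrand z
  · refine (hMa.hankelFun.add hHb).congr fun f => ae_of_all _ fun v => ?_
    have h1 := congrFun (hsplit f) v
    simp only [hankelFun]
    rw [hsplit, h1, fockProj_add (hai f) (hbi f)]
    ring

end hankel

end

theorem mainTheorem2 (p : ℝ≥0) [Fact (1 ≤ (p : ℝ≥0∞))] (m : ℕ) (r : ℝ) (hr : 0 < r)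
    (g : ℂ → ℂ) (hg : MemVMO p r g) :
    IsCompactHankel p m g ∧ IsCompactHankel p m (fun v => conj (g v)) :=
  ⟨isCompactHankel_of_memVMO hr hg, isCompactHankel_of_memVMO hr hg.conj⟩
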